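/- **Setting.** Let $T\ge 2$, $d\ge 1$. A bidder takes part in $T$ first-price auctions. In round $t\in[T]$ she sees a context $x_t\in\mathbb R^d$, $\|x_t\|_2\le 1$ (a deterministic sequence, chosen obliviously), bids $b_t\in[0,1]$, and then observes the highest other bid $M_t$ and either $v_{t,1}$ (if $b_t\ge M_t$) or $v_{t,0}$ (if $b_t<M_t$). Her payoff for a bid $b$ is $r_t(b)=\mathbf 1[b\ge M_t](v_{t,1}-b)+\mathbf 1[b<M_t]v_{t,0}$. Assume: $v_{t,0},v_{t,1}\in[0,1]$ almost surely; the vectors $(M_t,v_{t,0},v_{t,1})$, $t\in[T]$, are independent; $(v_{t,1},v_{t,0})$ is independent of $M_t$ for each $t$; $\mathbb E[v_{t,i}]=\theta_{*,i}^\top x_t$ for unknown $\theta_{*,i}\in\mathbb R^d$ with $\|\theta_{*,i}\|_2\le1$, $i=0,1$; the CDF $G_t$ of $M_t$ is $L$-Lipschitz on $[0,1]$ for some finite $L$. A (measurable) estimation oracle $\mathcal O$ computes from $\{(M_\tau,x_\tau)\}_{\tau<t}$ and $x_t$ an estimate $\widehat G_t$ with values in $[0,1]$, and there are numbers $\varepsilon_t$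 such that, with probability at least $1-T^{-1}$, $\sup_{b\in[0,1]}|\widehat G_t(b)-G_t(b)|\le\varepsilon_t$ for all $t\in[T]$. Let $\Delta=\sum_{t=1}^T\varepsilon_t$. **Base algorithm (LIN-PO).** For a set $\Phi$ of past rounds put $\beta=\sqrt{\log(2T)}$ and $A_1=I+\sum_{\tau\in\Phi}\mathbf 1[b_\tau\ge M_\tau]x_\tau x_\tau^\top$, $z_1=\sum_{\tau\in\Phi}\mathbf 1[b_\tau\ge M_\tau]v_{\tau,1}x_\tau$, define $A_0,z_0$ in the same way with $b_\tau<M_\tau$ and $v_{\tau,0}$, and let $\hat\theta_i=A_i^{-1}z_i$. For a bid $b$, with $\|x\|_A=\sqrt{x^\top Ax}$, let $$\widehat r_t(b)=\widehat G_t(b)(\hat\theta_1^\top x_t-b)+(1-\widehat G_t(b))\hat\theta_0^\top x_t,$$ $$w_t(b)=(\beta+1)\big(\widehat G_t(b)\|x_t\|_{A_1^{-1}}+(1-\widehat G_t(b))\|x_t\|_{A_0^{-1}}\big).$$ **Master algorithm (SUP-LIN-PO).** Let $S=\lceil\log_2\sqrt T\rceil$ and keep index sets $\Phi^{(1)},\dots,\Phi^{(S)}$,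 initially empty. In round $t$ start with $B_1=[0,1]$ and for $s=1,2,\dots,S$ compute $\widehat r^{(s)}_t,w^{(s)}_t$ from $\Phi^{(s)}$ by the base algorithm, and: (i) if some $b\in B_s$ has $w^{(s)}_t(b)>2^{-s}$, bid any such $b$, add $t$ to $\Phi^{(s)}$, and end the round; (ii) otherwise, if $w^{(s)}_t(b)\le 1/\sqrt T$ for all $b\in B_s$, bid a maximizer of $\widehat r^{(s)}_t$ over $B_s$ (any $b_t \in B_s$ with $\widehat r_t^{(s)}(b_t)\ge\sup_{B_s}\widehat r_t^{(s)}-1/\sqrt T$ is allowed), leave all index sets unchanged, and end the round; (iii) otherwise let $B_{s+1}=\{b\in B_s:\widehat r^{(s)}_t(b)+w^{(s)}_t(b)\ge\sup_{b'\in B_s}(\widehat r^{(s)}_t(b')+w^{(s)}_t(b'))-2\cdot2^{-s}\}$ and go on to stage $s+1$. The choice in (i) is an arbitrary deterministic function of $t$, $s$, $B_s$, the widths $w^{(s)}_t$, the contexts up to time $t$ and the past highest other bids (it does not look at the reward estimates of stage $s$), the choice in (ii) one of $t$, $s$, $B_s$, $\widehat r^{(s)}_t$, the contexts up to time $t$ and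 the past highest other bids; the choices are such that the bid and the stage in which each round ends depend measurably on the sequence of the $(M_t,v_{t,0},v_{t,1})$. **Theorem.** There is an absolute constant $C>0$ such that, for all $T$, $d$, oracles, choices and environments as above, the bids $b_t$ of the master algorithm satisfy $$\sum_{t=1}^T\big(\mathbb E[r_t(b_*(x_t))]-\mathbb E[r_t(b_t)]\big)\le C\Big(\sqrt{dT}\,\log^2T+\Delta\,\log^{3/2}T\Big),$$ where $b_*(x_t)\in\arg\max_{b\in[0,1]}\mathbb E[r_t(b)]$ is the optimal context-dependent bid. -/

import Mathlib

open MeasureTheory ProbabilityTheory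

open scoped NNReal ENNReal

noncomputable section

namespace Auction

/-- The context space `ℝ^d` with its Euclidean norm. -/
abbrev Ctx (d : ℕ) : Type := EuclideanSpace ℝ (Fin d)

/-- The bid space. -/
abbrev Bids : Set ℝ := Set.Icc 0 1

/-- The realized payoff of the bid `b` when the highest other bid is `m` and the potential
outcomes are `y₁` (auction won, i.e. `b ≥ m`) and `y₀` (auction lost, i.e. `b < m`). -/
def payoff (b m y₀ y₁ : ℝ) : ℝ := if m ≤ b then y₁ - b else y₀

/-! ### The base algorithm LIN-PO -/

/-- What the bidder remembers of a past round: the context, the highest other bid, her bid, the one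
potential outcome that she observed, and the stage `s ≥ 1` whose index set received the round
(`stage = 0` if the round was not put into any index set). -/
structure Round (d : ℕ) where
  ctx : Ctx d
  hob : ℝ
  bid : ℝ
  outcome : ℝ
  stage : ℕ

/-- The rounds in `Φ` that were won (`i = true`) or lost (`i = false`). -/
def group {d : ℕ} (i : Bool) (Φ : List (Round d)) : List (Round d) :=
  Φ.filter fun r => decide (r.hob ≤ r.bid) = i

/-- `A_i = I + ∑ x xᵀ`, the sum over the won (`i = true`) or lost (`i = false`) rounds of `Φ`. -/
def gram {d : ℕ} (i : Bool) (Φ : List (Round d)) : Matrix (Fin d) (Fin d) ℝ :=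
  1 + ((group i Φ).map fun r => Matrix.vecMulVec r.ctx.ofLp r.ctx.ofLp).sum

/-- `z_i = ∑ v x`, the sum over the won or lost rounds of `Φ`. -/
def moment {d : ℕ} (i : Bool) (Φ : List (Round d)) : Fin d → ℝ :=
  ((group i Φ).map fun r => r.outcome • r.ctx.ofLp).sum

/-- The ridge estimator `θ̂_i = A_i⁻¹ z_i`. -/
def thetaHat {d : ℕ} (i : Bool) (Φ : List (Round d)) : Fin d → ℝ :=
  (gram i Φ)⁻¹.mulVec (moment i Φ)

/-- The weighted norm `‖x‖_{A_i⁻¹}`. -/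
def gramNorm {d : ℕ} (i : Bool) (Φ : List (Round d)) (x : Ctx d) : ℝ :=
  √(x.ofLp ⬝ᵥ (gram i Φ)⁻¹.mulVec x.ofLp)

/-- The estimated reward of the bid `b`, for the estimated CDF `G`. -/
def rewardEst {d : ℕ} (Φ : List (Round d)) (x : Ctx d) (G : ℝ → ℝ) (b : ℝ) : ℝ :=
  G b * (thetaHat true Φ ⬝ᵥ x.ofLp - b) + (1 - G b) * (thetaHat false Φ ⬝ᵥ x.ofLp)

/-- The confidence width of the bid `b`, with `β = √(log (2T))` and `λ = 1`. -/
def width {d : ℕ} (T : ℕ) (Φ : List (Round d)) (x : Ctx d) (G : ℝ → ℝ) (b : ℝ) : ℝ :=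
  (√(Real.log (2 * T)) + 1) * G b * gramNorm true Φ x +
    (√(Real.log (2 * T)) + 1) * (1 - G b) * gramNorm false Φ x

/-! ### The master algorithm SUP-LIN-PO -/

/-- An estimation oracle: from the pairs (highest other bid, context) of the `t` past rounds and the
current context it computes an estimate, at every point `b`, of the CDF of the current highest
other bid. Only the range `[0, 1]` is required of the estimate. -/
structure CDFOracle (d : ℕ) where
  est : (t : ℕ) → (Fin t → ℝ × Ctx d) → Ctx d → ℝ → ℝ
  est_mem : ∀ t h x b, est t h x b ∈ Set.Icc (0 : ℝ) 1
  measurable_est : ∀ t, Measurable fun p : (Fin t → ℝ × Ctx d) × Ctx d × ℝ => est t p.1 p.2.1 p.2.2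

/-- How the algorithm with horizon `T` makes the choices that its description leaves open, in round
`t`, with past observations `h` of highest other bids and contexts, current context `x`, and stage
`s` with surviving bids `B`.

`explore` chooses any surviving bid whose width `w` exceeds `2^{-s}`; this choice may look at `B` and
at the widths, but not at the reward estimates of the current stage.
`exploit` chooses a maximizer over `B` of the estimated reward `r`; since `r` need not attain its
supremum, every surviving bid that maximizes `r` up to `1 / √T` is allowed. -/
structure SelectionRule (T d : ℕ) where
  explore : (t : ℕ) → (Fin t → ℝ × Ctx d) → Ctx d → (s : ℕ) → (B : Set ℝ) → (w : ℝ → ℝ) → ℝ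
  exploit : (t : ℕ) → (Fin t → ℝ × Ctx d) → Ctx d → (s : ℕ) → (B : Set ℝ) → (r : ℝ → ℝ) → ℝ
  explore_spec : ∀ t h x s B w, (∃ b ∈ B, (1 / 2 : ℝ) ^ s < w b) →
    explore t h x s B w ∈ B ∧ (1 / 2 : ℝ) ^ s < w (explore t h x s B w)
  exploit_spec : ∀ t h x s B r, B.Nonempty → BddAbove (r '' B) →
    exploit t h x s B r ∈ B ∧ ∀ b ∈ B, r b ≤ r (exploit t h x s B r) + 1 / √(T : ℝ)

/-- The number of stages `S = ⌈log₂ √T⌉`. -/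
def numStages (T : ℕ) : ℕ := ⌈Real.logb 2 √(T : ℝ)⌉₊

/-- The bids of `B` that survive stage `s`: those whose upper confidence bound is at least the
maximum over `B` minus `2 · 2^{-s}`. -/
def eliminate (s : ℕ) (r w : ℝ → ℝ) (B : Set ℝ) : Set ℝ :=
  {b ∈ B | ∀ b' ∈ B, r b' + w b' - 2 * (1 / 2 : ℝ) ^ s ≤ r b + w b}

open scoped Classical in
/-- The loop over the stages in one round, started at stage `s` with surviving bids `B` and with
`n` stages left. `past` holds the past rounds, `G` is the estimated CDF. It returns the bid and the
stage whose index set receives the round (`0` for none). For `n = numStages T` at `s = 1` the loop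
ends by one of its first two exits, and the value at `n = 0` is never used. -/
def stageLoop {T d : ℕ} (R : SelectionRule T d) (t : ℕ) (h : Fin t → ℝ × Ctx d)
    (past : List (Round d)) (x : Ctx d) (G : ℝ → ℝ) : (n s : ℕ) → (B : Set ℝ) → ℝ × ℕ
  | 0, _, _ => (0, 0)
  | n + 1, s, B =>
    let Φ := past.filter fun r => r.stage = s
    let r := rewardEst Φ x G
    let w := width T Φ x G
    if ∃ b ∈ B, (1 / 2 : ℝ) ^ s < w b then (R.explore t h x s B w, s)
    else if ∀ b ∈ B, w b ≤ 1 / √(T : ℝ) then (R.exploit t h x s B r, 0)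
    else stageLoop R t h past x G n (s + 1) (eliminate s r w B)

/-- One realization of the environment: in round `t` (counted from `0`) the highest other bid and the
potential outcomes `v_{t,0}`, `v_{t,1}`. -/
abbrev Trajectory : Type := ℕ → ℝ × ℝ × ℝ

/-- The estimated CDF in round `t`. -/
def estCDF {d : ℕ} (O : CDFOracle d) (x : ℕ → Ctx d) (z : Trajectory) (t : ℕ) : ℝ → ℝ :=
  O.est t (fun i => ((z i).1, x i)) (x t)

/-- The decision (bid and stage) in round `t`, given the list of the past rounds. -/
def roundDecision {T d : ℕ} (O : CDFOracle d) (R : SelectionRule T d) (x : ℕ → Ctx d) (z : Trajectory)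
    (t : ℕ) (past : List (Round d)) : ℝ × ℕ :=
  stageLoop R t (fun i => ((z i).1, x i)) past (x t) (estCDF O x z t) (numStages T) 1 Bids

/-- The rounds before round `t`, the most recent one first. -/
def history {T d : ℕ} (O : CDFOracle d) (R : SelectionRule T d) (x : ℕ → Ctx d) (z : Trajectory) :
    ℕ → List (Round d)
  | 0 => []
  | t + 1 =>
    let past := history O R x z t
    let p := roundDecision O R x z t past
    { ctx := x t
      hob := (z t).1
      bid := p.1
      outcome := if (z t).1 ≤ p.1 then (z t).2.2 else (z t).2.1
      stage := p.2 } :: past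

/-- The decision (bid and stage) of the algorithm in round `t`. -/
def decision {T d : ℕ} (O : CDFOracle d) (R : SelectionRule T d) (x : ℕ → Ctx d) (z : Trajectory)
    (t : ℕ) : ℝ × ℕ :=
  roundDecision O R x z t (history O R x z t)

/-! ### The model and the regret -/

/-- Linear potential outcomes over `T` rounds: the contexts `x` are a fixed sequence, `M t` is the
highest other bid and `v₀ t`, `v₁ t` are the potential outcomes in round `t`. -/
structure LinearPotentialOutcomes {Ω : Type*} [MeasurableSpace Ω] (μ : Measure Ω) (T : ℕ) {d : ℕ}
    (L : ℝ≥0) (x : ℕ → Ctx d) (θ₀ θ₁ : Ctx d) (M v₀ v₁ : ℕ → Ω → ℝ) : Prop where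
  measurable_M : ∀ t, Measurable (M t)
  measurable_v₀ : ∀ t, Measurable (v₀ t)
  measurable_v₁ : ∀ t, Measurable (v₁ t)
  norm_ctx : ∀ t < T, ‖x t‖ ≤ 1
  norm_θ₀ : ‖θ₀‖ ≤ 1
  norm_θ₁ : ‖θ₁‖ ≤ 1
  v₀_mem : ∀ t < T, ∀ᵐ ω ∂μ, v₀ t ω ∈ Set.Icc (0 : ℝ) 1
  v₁_mem : ∀ t < T, ∀ᵐ ω ∂μ, v₁ t ω ∈ Set.Icc (0 : ℝ) 1
  mean_v₀ : ∀ t < T, ∫ ω, v₀ t ω ∂μ = inner ℝ θ₀ (x t)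
  mean_v₁ : ∀ t < T, ∫ ω, v₁ t ω ∂μ = inner ℝ θ₁ (x t)
  /-- Independence over time. -/
  indep_time : iIndepFun (fun (t : Fin T) ω => (M t ω, v₀ t ω, v₁ t ω)) μ
  /-- Unconfoundedness. -/
  unconfounded : ∀ t < T, IndepFun (fun ω => (v₀ t ω, v₁ t ω)) (M t) μ
  /-- Bounded density of the highest other bid, on the bid space. -/
  lipschitz : ∀ t < T, LipschitzOnWith L (cdf (μ.map (M t))) Bids

/-- The random trajectory. -/
def trajectory {Ω : Type*} (M v₀ v₁ : ℕ → Ω → ℝ) (ω : Ω) : Trajectory :=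
  fun t => (M t ω, v₀ t ω, v₁ t ω)

/-- With probability at least `1 - 1 / T`, the estimated CDF is within `ε t` of the true one in sup
norm over the bid space, in every round `t`. -/
def OracleAccurate {Ω : Type*} [MeasurableSpace Ω] (μ : Measure Ω) (T : ℕ) {d : ℕ}
    (O : CDFOracle d) (x : ℕ → Ctx d) (M v₀ v₁ : ℕ → Ω → ℝ) (ε : ℕ → ℝ) : Prop :=
  μ {ω | ¬ ∀ t < T, ∀ b ∈ Bids,
    |estCDF O x (trajectory M v₀ v₁ ω) t b - cdf (μ.map (M t)) b| ≤ ε t} ≤ ENNReal.ofReal (1 / T)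

/-- `b` maximizes the expected payoff over the bid space, in a round with highest other bid `m` and
potential outcomes `y₀`, `y₁`. -/
def IsOptimalBid {Ω : Type*} [MeasurableSpace Ω] (μ : Measure Ω) (m y₀ y₁ : Ω → ℝ) (b : ℝ) : Prop :=
  b ∈ Bids ∧ IsMaxOn (fun b' => ∫ ω, payoff b' (m ω) (y₀ ω) (y₁ ω) ∂μ) Bids b

/-- The expected regret of the algorithm over `T` rounds against the bids `bstar`. -/
def regret {Ω : Type*} [MeasurableSpace Ω] (μ : Measure Ω) {T d : ℕ} (O : CDFOracle d)
    (R : SelectionRule T d) (x : ℕ → Ctx d) (M v₀ v₁ : ℕ → Ω → ℝ) (bstar : ℕ → ℝ) : ℝ :=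
  ∑ t ∈ Finset.range T,
    (∫ ω, payoff (bstar t) (M t ω) (v₀ t ω) (v₁ t ω) ∂μ -
      ∫ ω, payoff (decision O R x (trajectory M v₀ v₁ ω) t).1 (M t ω) (v₀ t ω) (v₁ t ω) ∂μ)

end Auction

end

/-! The argument follows SupLinUCB. The index sets are built so that the outcomes collected in one
set stay independent given the set. A confidence parameter of order `√(log T)` then suffices,
instead of one that grows with `√d`.

Independence. The widths of stage `s` depend on the contexts, the estimated CDF and the members of
the index set, but not on the outcomes in it. Membership is therefore decided by the highest other
bids and by outcomes from lower stages. Winning is decided by the bid and `M`, and by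
unconfoundedness this does not bias the outcomes. So changing outcomes inside a set cannot change
the set (`stageSet_eq_of_agree`), the event that the set equals a fixed `W` is independent of the
outcomes in `W`, and Hoeffding's inequality for fixed `W` carries over to the random set without a
union bound over sets (`measureReal_stage_noise_le`).

One round. On the good event the reward estimates err by at most the width plus `3 ε t`. The stages
keep a near-optimal bid alive and remove bids with a large gap (`stageLoop_regret`). Up to `O(S ε
t)`, exploring at stage `s` costs at most `8 · 2^{-s}`, which is less than `8` times the width of
the bid, and exploiting costs at most `3 / √T`.

Sum of the widths. A width mixes the norms of both groups, while a round enlarges only one Gram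
matrix. Since `M t` is independent of the past, the mixture taken with the true CDF is the
conditional mean of the norm in the group that the round joins (`integral_meanWidth`); passing from
the estimated CDF to the true one costs `(β + 1) ε t`. The elliptical potential bounds the realized
norms by `O(√(d T log T))` per stage and group. The factors `β` and `S` bring this to `√(d T) log²
T`. The bad event has probability at most `(S + 1) / T` and costs at most `3` per round. -/

namespace Auction

/-! ### Ridge regression -/

section Ridge

variable {d : ℕ} {ι : Type*}

/-- The regularized Gram matrix `I + ∑ x xᵀ`. -/
noncomputable def ridge (x : ι → Fin d → ℝ) (W : Finset ι) : Matrix (Fin d) (Fin d) ℝ :=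
  1 + ∑ τ ∈ W, Matrix.vecMulVec (x τ) (x τ)

theorem ridge_mulVec (x : ι → Fin d → ℝ) (W : Finset ι) (u : Fin d → ℝ) :
    (ridge x W).mulVec u = u + ∑ τ ∈ W, (x τ ⬝ᵥ u) • x τ := by
  simp [ridge, Matrix.add_mulVec, Matrix.sum_mulVec, Matrix.vecMulVec_mulVec]

theorem posDef_ridge (x : ι → Fin d → ℝ) (W : Finset ι) : (ridge x W).PosDef := by
  refine Matrix.PosDef.one.add_posSemidef (Matrix.posSemidef_sum _ fun τ _ => ?_)
  simpa using Matrix.posSemidef_vecMulVec_self_star (x τ)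

theorem isUnit_det_ridge (x : ι → Fin d → ℝ) (W : Finset ι) : IsUnit (ridge x W).det :=
  (posDef_ridge x W).det_pos.ne'.isUnit

/-- The squared weighted norm `yᵀ A⁻¹ y`. -/
noncomputable def ridgeForm (x : ι → Fin d → ℝ) (W : Finset ι) (y : Fin d → ℝ) : ℝ :=
  y ⬝ᵥ (ridge x W)⁻¹.mulVec y

theorem ridge_mulVec_inv_mulVec (x : ι → Fin d → ℝ) (W : Finset ι) (y : Fin d → ℝ) :
    (ridge x W).mulVec ((ridge x W)⁻¹.mulVec y) = y := by
  rw [Matrix.mulVec_mulVec, Matrix.mul_nonsing_inv _ (isUnit_det_ridge x W), Matrix.one_mulVec]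

theorem ridge_inv_transpose (x : ι → Fin d → ℝ) (W : Finset ι) :
    ((ridge x W)⁻¹).transpose = (ridge x W)⁻¹ := by
  have h := (posDef_ridge x W).inv.isHermitian
  rwa [Matrix.IsHermitian, Matrix.conjTranspose_eq_transpose_of_trivial] at h

theorem dotProduct_ridge_inv_comm (x : ι → Fin d → ℝ) (W : Finset ι) (y z : Fin d → ℝ) :
    y ⬝ᵥ (ridge x W)⁻¹.mulVec z = (ridge x W)⁻¹.mulVec y ⬝ᵥ z := by
  rw [Matrix.dotProduct_mulVec, ← Matrix.mulVec_transpose, ridge_inv_transpose]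

/-- Expand `y = A u` with `u = A⁻¹ y` inside `yᵀ u`. Both summands are nonnegative: the first one
controls the regularization bias, the second is the sum of squared weights of the noise in the ridge
estimate. -/
theorem ridgeForm_eq (x : ι → Fin d → ℝ) (W : Finset ι) (y : Fin d → ℝ) :
    ridgeForm x W y = (ridge x W)⁻¹.mulVec y ⬝ᵥ (ridge x W)⁻¹.mulVec y +
      ∑ τ ∈ W, (y ⬝ᵥ (ridge x W)⁻¹.mulVec (x τ)) ^ 2 := by
  set u := (ridge x W)⁻¹.mulVec y with hu
  have h : y = u + ∑ τ ∈ W, (x τ ⬝ᵥ u) • x τ := by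
    rw [← ridge_mulVec, hu, ridge_mulVec_inv_mulVec]
  have h1 : ridgeForm x W y = y ⬝ᵥ u := rfl
  rw [h1]
  conv_lhs => rw [h]
  rw [add_dotProduct, sum_dotProduct]
  congr 1
  refine Finset.sum_congr rfl fun τ _ => ?_
  rw [smul_dotProduct, smul_eq_mul, dotProduct_ridge_inv_comm, dotProduct_comm _ y, sq]

theorem dotProduct_self_nonneg_real (u : Fin d → ℝ) : 0 ≤ u ⬝ᵥ u :=
  Finset.sum_nonneg fun _ _ => mul_self_nonneg _

theorem sum_sq_le_ridgeForm (x : ι → Fin d → ℝ) (W : Finset ι) (y : Fin d → ℝ) :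
    ∑ τ ∈ W, (y ⬝ᵥ (ridge x W)⁻¹.mulVec (x τ)) ^ 2 ≤ ridgeForm x W y := by
  rw [ridgeForm_eq]
  exact le_add_of_nonneg_left (dotProduct_self_nonneg_real _)

theorem dotProduct_inv_le_ridgeForm (x : ι → Fin d → ℝ) (W : Finset ι) (y : Fin d → ℝ) :
    (ridge x W)⁻¹.mulVec y ⬝ᵥ (ridge x W)⁻¹.mulVec y ≤ ridgeForm x W y := by
  rw [ridgeForm_eq x W y]
  exact le_add_of_nonneg_right (Finset.sum_nonneg fun _ _ => sq_nonneg _)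

theorem ridgeForm_nonneg (x : ι → Fin d → ℝ) (W : Finset ι) (y : Fin d → ℝ) :
    0 ≤ ridgeForm x W y :=
  (dotProduct_self_nonneg_real _).trans (dotProduct_inv_le_ridgeForm x W y)

theorem sq_dotProduct_le (u v : Fin d → ℝ) : (u ⬝ᵥ v) ^ 2 ≤ (u ⬝ᵥ u) * (v ⬝ᵥ v) := by
  simpa [dotProduct, sq] using Finset.sum_mul_sq_le_sq_mul_sq Finset.univ u v

/-- Cauchy-Schwarz gives `(yᵀ u)² ≤ |y|² |u|²` for `u = A⁻¹ y`, and `|u|² ≤ yᵀ u`; cancel one factor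
`yᵀ u`. -/
theorem ridgeForm_le (x : ι → Fin d → ℝ) (W : Finset ι) (y : Fin d → ℝ) :
    ridgeForm x W y ≤ y ⬝ᵥ y := by
  have h1 := dotProduct_inv_le_ridgeForm x W y
  have h2 : ridgeForm x W y ^ 2 ≤ _ := sq_dotProduct_le y ((ridge x W)⁻¹.mulVec y)
  have h3 := dotProduct_self_nonneg_real y
  have h0 := ridgeForm_nonneg x W y
  rcases h0.eq_or_lt with h | h
  · rwa [← h]
  · have : ridgeForm x W y * ridgeForm x W y ≤ (y ⬝ᵥ y) * ridgeForm x W y := by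
      nlinarith [mul_le_mul_of_nonneg_left h1 h3]
    exact le_of_mul_le_mul_right this h

/-- Bounds the regularization bias; it accounts for the `1` in the factor `β + 1` of the width. -/
theorem abs_dotProduct_inv_le (x : ι → Fin d → ℝ) (W : Finset ι) (y θ : Fin d → ℝ)
    (hθ : θ ⬝ᵥ θ ≤ 1) : |y ⬝ᵥ (ridge x W)⁻¹.mulVec θ| ≤ √(ridgeForm x W y) := by
  refine Real.abs_le_sqrt ?_
  rw [dotProduct_ridge_inv_comm]
  refine (sq_dotProduct_le _ _).trans ?_
  exact (mul_le_of_le_one_right (dotProduct_self_nonneg_real _) hθ).trans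
    (dotProduct_inv_le_ridgeForm x W y)

/-- The error of the ridge estimator is the weighted noise plus the regularization bias. -/
theorem ridge_estimate_sub (x : ι → Fin d → ℝ) (W : Finset ι) (v : ι → ℝ) (y θ : Fin d → ℝ) :
    (ridge x W)⁻¹.mulVec (∑ τ ∈ W, v τ • x τ) ⬝ᵥ y - θ ⬝ᵥ y =
      ∑ τ ∈ W, (y ⬝ᵥ (ridge x W)⁻¹.mulVec (x τ)) * (v τ - θ ⬝ᵥ x τ) -
        y ⬝ᵥ (ridge x W)⁻¹.mulVec θ := by
  have h : θ = (ridge x W)⁻¹.mulVec θ +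
      ∑ τ ∈ W, (x τ ⬝ᵥ θ) • (ridge x W)⁻¹.mulVec (x τ) := by
    have h1 : (ridge x W)⁻¹.mulVec ((ridge x W).mulVec θ) = θ := by
      rw [Matrix.mulVec_mulVec, Matrix.nonsing_inv_mul _ (isUnit_det_ridge x W),
        Matrix.one_mulVec]
    rw [ridge_mulVec, Matrix.mulVec_add, Matrix.mulVec_sum] at h1
    simpa only [Matrix.mulVec_smul] using h1.symm
  have h2 : θ ⬝ᵥ y = y ⬝ᵥ (ridge x W)⁻¹.mulVec θ +
      ∑ τ ∈ W, (x τ ⬝ᵥ θ) * (y ⬝ᵥ (ridge x W)⁻¹.mulVec (x τ)) := by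
    rw [dotProduct_comm θ y]
    conv_lhs => rw [h]
    simp [dotProduct_add, dotProduct_sum, dotProduct_smul]
  rw [h2, dotProduct_comm _ y, Matrix.mulVec_sum, dotProduct_sum]
  simp only [Matrix.mulVec_smul, dotProduct_smul, smul_eq_mul, mul_sub, Finset.sum_sub_distrib]
  simp only [dotProduct_comm θ, mul_comm]
  ring

/-! ### Growth of the determinant of the Gram matrix. -/

theorem det_ridge_insert [DecidableEq ι] (x : ι → Fin d → ℝ) (W : Finset ι) {τ : ι} (h : τ ∉ W) :
    (ridge x (insert τ W)).det = (ridge x W).det * (1 + ridgeForm x W (x τ)) := by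
  have h1 : ridge x (insert τ W) =
      ridge x W + Matrix.replicateCol Unit (x τ) * Matrix.replicateRow Unit (x τ) := by
    rw [ridge, ridge, Finset.sum_insert h, Matrix.vecMulVec_eq Unit]
    abel
  rw [h1, Matrix.det_add_replicateCol_mul_replicateRow (isUnit_det_ridge x W), ridgeForm,
    Matrix.det_unique (n := Unit), Matrix.mul_assoc]
  simp [Matrix.mul_apply, Matrix.mulVec, dotProduct]

theorem trace_ridge_le (x : ι → Fin d → ℝ) (W : Finset ι) (hx : ∀ τ ∈ W, x τ ⬝ᵥ x τ ≤ 1) :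
    (ridge x W).trace ≤ d + W.card := by
  simp only [ridge, Matrix.trace_add, Matrix.trace_one, Matrix.trace_sum, Matrix.trace_vecMulVec,
    Fintype.card_fin]
  gcongr
  simpa using Finset.sum_le_card_nsmul W _ 1 hx

/-- Bound the logarithm of each eigenvalue by the tangent of `log` at `1 + n`. The linear terms
cancel because the trace is at most `d + n ≤ d (1 + n)`. -/
theorem log_det_ridge_le (hd : 1 ≤ d) (x : ι → Fin d → ℝ) (W : Finset ι)
    (hx : ∀ τ ∈ W, x τ ⬝ᵥ x τ ≤ 1) {n : ℕ} (hn : W.card ≤ n) :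
    Real.log (ridge x W).det ≤ d * Real.log (1 + n) := by
  have hP := posDef_ridge x W
  have hH := hP.isHermitian
  have hK : (0 : ℝ) < 1 + n := by positivity
  have hd' : (1 : ℝ) ≤ d := by exact_mod_cast hd
  have hn' : (W.card : ℝ) ≤ n := by exact_mod_cast hn
  have htr : ∑ i, hH.eigenvalues i ≤ d + W.card := by
    have := hH.trace_eq_sum_eigenvalues
    simp only [RCLike.ofReal_real_eq_id, id] at this
    rw [← this]
    exact trace_ridge_le x W hx
  rw [hH.det_eq_prod_eigenvalues]
  simp only [RCLike.ofReal_real_eq_id, id]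
  rw [Real.log_prod fun i _ => (hP.eigenvalues_pos i).ne']
  calc ∑ i, Real.log (hH.eigenvalues i)
      ≤ ∑ i, (hH.eigenvalues i / (1 + n) - 1 + Real.log (1 + n)) := by
        refine Finset.sum_le_sum fun i _ => ?_
        have h1 := hP.eigenvalues_pos i
        have h2 := Real.log_le_sub_one_of_pos (div_pos h1 hK)
        rw [Real.log_div h1.ne' hK.ne'] at h2
        linarith
    _ = (∑ i, hH.eigenvalues i) / (1 + n) - d + d * Real.log (1 + n) := by
        rw [Finset.sum_add_distrib, Finset.sum_sub_distrib, ← Finset.sum_div]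
        simp
    _ ≤ d * Real.log (1 + n) := by
        have : (∑ i, hH.eigenvalues i) / (1 + n) ≤ d := by
          rw [div_le_iff₀ hK]
          nlinarith
        linarith

theorem le_two_mul_log_one_add {u : ℝ} (h0 : 0 ≤ u) (h1 : u ≤ 1) : u ≤ 2 * Real.log (1 + u) := by
  have h : 0 < 1 + u := by linarith
  have h2 := Real.one_sub_inv_le_log_of_pos h
  have h3 : u / 2 ≤ 1 - (1 + u)⁻¹ := by
    rw [show 1 - (1 + u)⁻¹ = u / (1 + u) by field_simp; ring]
    exact div_le_div_of_nonneg_left h0 h (by linarith)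
  linarith

/-- By the rank-one determinant formula the log-determinant grows by `log (1 + u)`, where `u` is the
form; `u ≤ 1` makes this at least `u / 2`. -/
theorem ridgeForm_le_log_det [DecidableEq ι] (x : ι → Fin d → ℝ) (W : Finset ι) {τ : ι} (h : τ ∉ W)
    (hx : x τ ⬝ᵥ x τ ≤ 1) : ridgeForm x W (x τ) ≤
      2 * Real.log (ridge x (insert τ W)).det - 2 * Real.log (ridge x W).det := by
  have h0 := ridgeForm_nonneg x W (x τ)
  rw [det_ridge_insert x W h, Real.log_mul (posDef_ridge x W).det_pos.ne' (by positivity)]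
  linarith [le_two_mul_log_one_add h0 ((ridgeForm_le x W _).trans hx)]

end Ridge

/-! ### The index sets of the master algorithm -/

section Design

variable {T d : ℕ} (O : CDFOracle d) (R : SelectionRule T d) (x : ℕ → Ctx d)

/-- The outcome that is observed on winning (`i = true`) or losing (`i = false`). -/
def potential (i : Bool) (p : ℝ × ℝ × ℝ) : ℝ := if i then p.2.2 else p.2.1

/-- The record of the round `τ`. -/
noncomputable def record (z : Trajectory) (τ : ℕ) : Round d where
  ctx := x τ
  hob := (z τ).1
  bid := (decision O R x z τ).1
  outcome := if (z τ).1 ≤ (decision O R x z τ).1 then (z τ).2.2 else (z τ).2.1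
  stage := (decision O R x z τ).2

theorem history_succ (z : Trajectory) (t : ℕ) :
    history O R x z (t + 1) = record O R x z t :: history O R x z t := rfl

/-- The index set of stage `s` before round `t`, with the outcomes. -/
noncomputable def stageRounds (z : Trajectory) (s t : ℕ) : List (Round d) :=
  (history O R x z t).filter fun r => r.stage = s

/-- The rounds before `t` in the index set of stage `s` that were won (`i = true`) or lost
(`i = false`). -/
noncomputable def stageSet (z : Trajectory) (s : ℕ) (i : Bool) (t : ℕ) : Finset ℕ :=
  (Finset.range t).filter fun τ => (decision O R x z τ).2 = s ∧
    decide ((z τ).1 ≤ (decision O R x z τ).1) = i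

theorem mem_stageSet {z : Trajectory} {s : ℕ} {i : Bool} {t τ : ℕ} :
    τ ∈ stageSet O R x z s i t ↔ τ < t ∧ (decision O R x z τ).2 = s ∧
      decide ((z τ).1 ≤ (decision O R x z τ).1) = i := by
  simp [stageSet]

theorem stageSet_subset (z : Trajectory) (s : ℕ) (i : Bool) (t : ℕ) :
    stageSet O R x z s i t ⊆ Finset.range t := Finset.filter_subset _ _

/-- Passes from the algorithm's lists of records to sums over sets of round numbers. Both the Gram
matrix and the moment vector have this shape. -/
theorem sum_map_group {α : Type*} [AddCommMonoid α] (f : Round d → α) (z : Trajectory) (s : ℕ)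
    (i : Bool) (t : ℕ) : ((group i (stageRounds O R x z s t)).map f).sum =
      ∑ τ ∈ stageSet O R x z s i t, f (record O R x z τ) := by
  induction t with
  | zero => simp [group, stageRounds, history, stageSet]
  | succ t ih =>
    rw [group, stageRounds] at ih ⊢
    rw [stageSet, Finset.range_add_one, Finset.filter_insert, history_succ, List.filter_filter]
    rw [List.filter_filter] at ih
    rw [List.filter_cons]
    by_cases h : (decision O R x z t).2 = s ∧ decide ((z t).1 ≤ (decision O R x z t).1) = i
    · rw [if_pos h, if_pos (by simp [record, h.1, h.2]), Finset.sum_insert (by simp),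
        List.map_cons, List.sum_cons, ih, stageSet]
    · rw [if_neg h, if_neg (by rw [Bool.and_eq_true, decide_eq_true_iff, decide_eq_true_iff, and_comm]; exact h), ih, stageSet]

/-- The contexts as plain vectors. -/
def vec (τ : ℕ) : Fin d → ℝ := (x τ).ofLp

theorem gram_stageRounds (z : Trajectory) (s : ℕ) (i : Bool) (t : ℕ) :
    gram i (stageRounds O R x z s t) = ridge (vec x) (stageSet O R x z s i t) := by
  rw [gram, sum_map_group]
  rfl

theorem moment_stageRounds (z : Trajectory) (s : ℕ) (i : Bool) (t : ℕ) :
    moment i (stageRounds O R x z s t) =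
      ∑ τ ∈ stageSet O R x z s i t, potential i (z τ) • vec x τ := by
  rw [moment, sum_map_group]
  refine Finset.sum_congr rfl fun τ hτ => ?_
  have h := ((mem_stageSet O R x).1 hτ).2.2
  cases i <;> simp at h <;> simp [record, potential, vec, h]

theorem gramNorm_stageRounds (z : Trajectory) (s : ℕ) (i : Bool) (t : ℕ) (y : Ctx d) :
    gramNorm i (stageRounds O R x z s t) y =
      √(ridgeForm (vec x) (stageSet O R x z s i t) y.ofLp) := by
  rw [gramNorm, gram_stageRounds]
  rfl

/-- Outcomes do not enter the widths. This is why exploration at a stage is blind to the outcomes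
stored there. -/
theorem width_eq_of_stageSet_eq {z z' : Trajectory} {s t : ℕ}
    (h : ∀ i, stageSet O R x z s i t = stageSet O R x z' s i t) (y : Ctx d) (G : ℝ → ℝ) :
    width T (stageRounds O R x z s t) y G = width T (stageRounds O R x z' s t) y G := by
  funext b
  simp only [width, gramNorm_stageRounds, h]

end Design

/-! ### The stages up to `s` ignore the outcomes in the index set of stage `s` -/

/-- The decision, if it was taken by exploration at a stage up to `s`. -/
def upToStage (s : ℕ) (p : ℝ × ℕ) : Option (ℝ × ℕ) :=
  if 1 ≤ p.2 ∧ p.2 ≤ s then some p else none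

theorem upToStage_eq {s : ℕ} {p q : ℝ × ℕ} (h : upToStage s p = upToStage s q) (h1 : 1 ≤ p.2)
    (h2 : p.2 ≤ s) : p = q := by
  unfold upToStage at h
  rw [if_pos ⟨h1, h2⟩] at h
  split_ifs at h
  exact Option.some_injective _ h

theorem stageLoop_explore {T d : ℕ} (R : SelectionRule T d) (t : ℕ) (h : Fin t → ℝ × Ctx d)
    (past : List (Round d)) (x : Ctx d) (G : ℝ → ℝ) (n s : ℕ) (B : Set ℝ)
    (h1 : ∃ b ∈ B, (1 / 2 : ℝ) ^ s < width T (past.filter fun r => r.stage = s) x G b) :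
    stageLoop R t h past x G (n + 1) s B =
      (R.explore t h x s B (width T (past.filter fun r => r.stage = s) x G), s) := by
  simp only [stageLoop]
  rw [if_pos h1]

theorem stageLoop_exploit {T d : ℕ} (R : SelectionRule T d) (t : ℕ) (h : Fin t → ℝ × Ctx d)
    (past : List (Round d)) (x : Ctx d) (G : ℝ → ℝ) (n s : ℕ) (B : Set ℝ)
    (h1 : ¬ ∃ b ∈ B, (1 / 2 : ℝ) ^ s < width T (past.filter fun r => r.stage = s) x G b)
    (h2 : ∀ b ∈ B, width T (past.filter fun r => r.stage = s) x G b ≤ 1 / √(T : ℝ)) :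
    stageLoop R t h past x G (n + 1) s B =
      (R.exploit t h x s B (rewardEst (past.filter fun r => r.stage = s) x G), 0) := by
  simp only [stageLoop]
  rw [if_neg h1, if_pos h2]

theorem stageLoop_next {T d : ℕ} (R : SelectionRule T d) (t : ℕ) (h : Fin t → ℝ × Ctx d)
    (past : List (Round d)) (x : Ctx d) (G : ℝ → ℝ) (n s : ℕ) (B : Set ℝ)
    (h1 : ¬ ∃ b ∈ B, (1 / 2 : ℝ) ^ s < width T (past.filter fun r => r.stage = s) x G b)
    (h2 : ¬ ∀ b ∈ B, width T (past.filter fun r => r.stage = s) x G b ≤ 1 / √(T : ℝ)) :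
    stageLoop R t h past x G (n + 1) s B =
      stageLoop R t h past x G n (s + 1)
        (eliminate s (rewardEst (past.filter fun r => r.stage = s) x G)
          (width T (past.filter fun r => r.stage = s) x G) B) := by
  conv_lhs => simp only [stageLoop]
  rw [if_neg h1, if_neg h2]

theorem stageLoop_stage {T d : ℕ} (R : SelectionRule T d) (t : ℕ) (h : Fin t → ℝ × Ctx d)
    (past : List (Round d)) (x : Ctx d) (G : ℝ → ℝ) (n s : ℕ) (B : Set ℝ) :
    (stageLoop R t h past x G n s B).2 = 0 ∨ s ≤ (stageLoop R t h past x G n s B).2 ∧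
      (stageLoop R t h past x G n s B).2 < s + n := by
  induction n generalizing s B with
  | zero => simp [stageLoop]
  | succ n ih =>
    simp only [stageLoop]
    split_ifs
    · right; simp
    · left; rfl
    · rcases ih (s + 1) (eliminate s _ _ B) with h | h
      · exact Or.inl h
      · exact Or.inr ⟨by omega, by omega⟩

theorem upToStage_stageLoop_of_lt {T d : ℕ} (R : SelectionRule T d) (t : ℕ) (h : Fin t → ℝ × Ctx d)
    (past : List (Round d)) (x : Ctx d) (G : ℝ → ℝ) (n s j : ℕ) (B : Set ℝ) (hj : s < j) :
    upToStage s (stageLoop R t h past x G n j B) = none := by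
  unfold upToStage
  rw [if_neg]
  rcases stageLoop_stage R t h past x G n j B with h | h <;> omega

/-- Below stage `s` the two loops see the same data and run identically. At stage `s` the equal
widths fix which exit is taken and the explored bid; every other exit leads to a stage outside `1,
..., s`, so the differing reward estimates go unnoticed. -/
theorem upToStage_stageLoop_congr {T d : ℕ} (R : SelectionRule T d) (t : ℕ)
    (h : Fin t → ℝ × Ctx d) (past past' : List (Round d)) (x : Ctx d) (G : ℝ → ℝ) (s : ℕ)
    (hlt : ∀ j, 1 ≤ j → j < s → (past.filter fun r => r.stage = j) =
      past'.filter fun r => r.stage = j)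
    (hw : width T (past.filter fun r => r.stage = s) x G =
      width T (past'.filter fun r => r.stage = s) x G) (n j : ℕ) (B : Set ℝ) (hj1 : 1 ≤ j) :
    upToStage s (stageLoop R t h past x G n j B) =
      upToStage s (stageLoop R t h past' x G n j B) := by
  induction n generalizing j B with
  | zero => rfl
  | succ n ih =>
    rcases lt_trichotomy j s with hj | hj | hj
    · by_cases h1 : ∃ b ∈ B, (1 / 2 : ℝ) ^ j < width T (past'.filter fun r => r.stage = j) x G b
      · rw [stageLoop_explore R t h past' x G n j B h1, stageLoop_explore R t h past x G n j B]
        · rw [hlt j hj1 hj]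
        · rwa [hlt j hj1 hj]
      by_cases h2 : ∀ b ∈ B, width T (past'.filter fun r => r.stage = j) x G b ≤ 1 / √(T : ℝ)
      · rw [stageLoop_exploit R t h past' x G n j B h1 h2, stageLoop_exploit R t h past x G n j B]
        · rw [hlt j hj1 hj]
        · rwa [hlt j hj1 hj]
        · rwa [hlt j hj1 hj]
      · rw [stageLoop_next R t h past' x G n j B h1 h2, stageLoop_next R t h past x G n j B]
        · rw [hlt j hj1 hj]
          exact ih _ _ (by omega)
        · rwa [hlt j hj1 hj]
        · rwa [hlt j hj1 hj]
    · subst hj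
      by_cases h1 : ∃ b ∈ B, (1 / 2 : ℝ) ^ j < width T (past'.filter fun r => r.stage = j) x G b
      · rw [stageLoop_explore R t h past' x G n j B h1, stageLoop_explore R t h past x G n j B]
        · rw [hw]
        · rwa [hw]
      by_cases h2 : ∀ b ∈ B, width T (past'.filter fun r => r.stage = j) x G b ≤ 1 / √(T : ℝ)
      · rw [stageLoop_exploit R t h past' x G n j B h1 h2, stageLoop_exploit R t h past x G n j B]
        · simp [upToStage]
        · rwa [hw]
        · rwa [hw]
      · rw [stageLoop_next R t h past' x G n j B h1 h2, stageLoop_next R t h past x G n j B]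
        · rw [upToStage_stageLoop_of_lt _ _ _ _ _ _ _ _ _ _ (Nat.lt_succ_self j),
            upToStage_stageLoop_of_lt _ _ _ _ _ _ _ _ _ _ (Nat.lt_succ_self j)]
        · rwa [hw]
        · rwa [hw]
    · rw [upToStage_stageLoop_of_lt _ _ _ _ _ _ _ _ _ _ hj,
        upToStage_stageLoop_of_lt _ _ _ _ _ _ _ _ _ _ hj]

section Invariance

variable {T d : ℕ} (O : CDFOracle d) (R : SelectionRule T d) (x : ℕ → Ctx d)

theorem history_congr {z z' : Trajectory} {t : ℕ} (h : ∀ τ < t, z τ = z' τ) :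
    history O R x z t = history O R x z' t := by
  induction t with
  | zero => rfl
  | succ t ih =>
    have h1 := ih fun τ hτ => h τ (by omega)
    have h2 : decision O R x z t = decision O R x z' t := by
      unfold decision roundDecision estCDF
      rw [h1]
      have : (fun i : Fin t => ((z i).1, x i)) = fun i : Fin t => ((z' i).1, x i) := by
        funext i; rw [h i (by omega)]
      rw [this]
    rw [history_succ, history_succ, h1, record, record, h2, h t (by omega)]

theorem decision_congr {z z' : Trajectory} {t : ℕ} (h : ∀ τ < t, z τ = z' τ) :
    decision O R x z t = decision O R x z' t := by
  unfold decision roundDecision estCDF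
  rw [history_congr O R x h]
  have : (fun i : Fin t => ((z i).1, x i)) = fun i : Fin t => ((z' i).1, x i) := by
    funext i; rw [h i (by omega)]
  rw [this]

theorem stageSet_congr {z z' : Trajectory} {t : ℕ} (h : ∀ τ < t, z τ = z' τ) (s : ℕ) (i : Bool) :
    stageSet O R x z s i t = stageSet O R x z' s i t := by
  ext τ
  simp only [mem_stageSet]
  refine and_congr_right fun hτ => ?_
  rw [decision_congr O R x fun τ' h' => h τ' (h'.trans hτ), h τ hτ]

/-- Strong induction over the rounds: earlier agreement up to stage `s` gives equal data at the
lower stages and equal index sets at stage `s`, hence equal widths there. Decisions at higher stages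
may differ but are never consulted. -/
theorem upToStage_decision_congr {z z' : Trajectory} {s t : ℕ}
    (hM : ∀ τ < t, (z τ).1 = (z' τ).1)
    (hv : ∀ τ < t, (decision O R x z τ).2 ≠ s → z τ = z' τ) :
    ∀ τ < t, upToStage s (decision O R x z τ) = upToStage s (decision O R x z' τ) := by
  intro τ
  induction τ using Nat.strong_induction_on with
  | _ τ ih =>
  intro hτ
  have hmem : ∀ σ < τ, ∀ j, 1 ≤ j → j ≤ s → ((decision O R x z σ).2 = j ∨
      (decision O R x z' σ).2 = j) → decision O R x z σ = decision O R x z' σ := by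
    intro σ hσ j h1 h2 hj
    have h3 := ih σ hσ (hσ.trans hτ)
    rcases hj with hj | hj
    · exact upToStage_eq h3 (hj ▸ h1) (hj ▸ h2)
    · exact (upToStage_eq h3.symm (hj ▸ h1) (hj ▸ h2)).symm
  have hlt : ∀ j, 1 ≤ j → j < s → ∀ ρ ≤ τ,
      stageRounds O R x z j ρ = stageRounds O R x z' j ρ := by
    intro j h1 h2 ρ hρ
    induction ρ with
    | zero => rfl
    | succ ρ ihρ =>
      have h3 := ihρ (by omega)
      unfold stageRounds at h3 ⊢
      rw [history_succ, history_succ, List.filter_cons, List.filter_cons, h3]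
      -- A round stored at a stage `j < s` in either run has the same decision in both, and its
      -- outcome was not changed, so the stored records coincide.
      by_cases hj : (decision O R x z ρ).2 = j ∨ (decision O R x z' ρ).2 = j
      · have h4 := hmem ρ (by omega) j h1 h2.le hj
        have h5 : (decision O R x z ρ).2 = j := by
          rcases hj with hj | hj
          · exact hj
          · rw [h4, hj]
        have h6 : record O R x z ρ = record O R x z' ρ := by
          rw [record, record, h4, hv ρ (by omega) (by omega)]
        rw [h6]
      · push Not at hj
        rw [if_neg (by simp [record, hj.1]), if_neg (by simp [record, hj.2])]
  have hset : ∀ i, 1 ≤ s → stageSet O R x z s i τ = stageSet O R x z' s i τ := by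
    intro i hs
    ext σ
    simp only [mem_stageSet]
    refine and_congr_right fun hσ => ?_
    constructor
    · rintro ⟨h1, h2⟩
      rw [← hmem σ hσ s hs le_rfl (Or.inl h1), ← hM σ (by omega)]
      exact ⟨h1, h2⟩
    · rintro ⟨h1, h2⟩
      rw [hmem σ hσ s hs le_rfl (Or.inr h1), hM σ (by omega)]
      exact ⟨h1, h2⟩
  rcases Nat.eq_zero_or_pos s with rfl | hs
  · have (p : ℝ × ℕ) : upToStage 0 p = none := by
      unfold upToStage; rw [if_neg]; omega
    rw [this, this]
  have hG : (fun i : Fin τ => ((z i).1, x i)) = fun i : Fin τ => ((z' i).1, x i) := by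
    funext i; rw [hM i (by omega)]
  unfold decision roundDecision estCDF
  rw [hG]
  exact upToStage_stageLoop_congr R τ _ _ _ _ _ s (fun j h1 h2 => hlt j h1 h2 τ le_rfl)
    (width_eq_of_stageSet_eq O R x (fun i => hset i hs) _ _) _ _ _ le_rfl

/-- Changing outcomes (but not the highest other bids) in rounds of the index set of stage `s` does
not change this set. -/
theorem stageSet_eq_of_agree {z z' : Trajectory} {s t : ℕ} {i : Bool} (hs : 1 ≤ s)
    (hM : ∀ τ < t, (z τ).1 = (z' τ).1)
    (hv : ∀ τ < t, τ ∉ stageSet O R x z s i t → z τ = z' τ) :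
    stageSet O R x z s i t = stageSet O R x z' s i t := by
  have h := upToStage_decision_congr O R x hM fun τ hτ hne => hv τ hτ fun hmem =>
    hne ((mem_stageSet O R x).1 hmem).2.1
  ext τ
  simp only [mem_stageSet]
  refine and_congr_right fun hτ => ?_
  constructor
  · rintro ⟨h1, h2⟩
    rw [← upToStage_eq (h τ hτ) (h1 ▸ hs) h1.le, ← hM τ hτ]
    exact ⟨h1, h2⟩
  · rintro ⟨h1, h2⟩
    rw [← upToStage_eq (h τ hτ).symm (h1 ▸ hs) h1.le, hM τ hτ]
    exact ⟨h1, h2⟩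

end Invariance

/-! ### Analysis of one round -/

/-- The expected payoff of the bid `b` when the highest other bid has CDF `g` and the potential
outcomes have means `p` (auction won) and `q` (auction lost). -/
def meanReward (g : ℝ → ℝ) (p q b : ℝ) : ℝ := g b * (p - b) + (1 - g b) * q

theorem gramNorm_nonneg {d : ℕ} (i : Bool) (Φ : List (Round d)) (x : Ctx d) :
    0 ≤ gramNorm i Φ x := Real.sqrt_nonneg _

/-- The error splits into the two parameter errors weighted by the estimated CDF, which add up to
the width, and the CDF error times `p - b - q`, whose modulus is at most `3`. -/
theorem abs_rewardEst_sub_le {T d : ℕ} {Φ : List (Round d)} {x : Ctx d} {G g : ℝ → ℝ}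
    {p q b e : ℝ} (hG : G b ∈ Set.Icc (0 : ℝ) 1) (hb : b ∈ Bids) (hp : |p| ≤ 1) (hq : |q| ≤ 1)
    (he : |G b - g b| ≤ e)
    (h1 : |thetaHat true Φ ⬝ᵥ x.ofLp - p| ≤ (√(Real.log (2 * T)) + 1) * gramNorm true Φ x)
    (h0 : |thetaHat false Φ ⬝ᵥ x.ofLp - q| ≤ (√(Real.log (2 * T)) + 1) * gramNorm false Φ x) :
    |rewardEst Φ x G b - meanReward g p q b| ≤ width T Φ x G b + 3 * e := by
  have hG0 : 0 ≤ 1 - G b := by linarith [hG.2]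
  have hpq : |p - b - q| ≤ 3 := by
    rw [abs_le] at *
    constructor <;> linarith [hb.1, hb.2]
  have e1 : rewardEst Φ x G b - meanReward g p q b =
      G b * (thetaHat true Φ ⬝ᵥ x.ofLp - p) + (1 - G b) * (thetaHat false Φ ⬝ᵥ x.ofLp - q) +
        (G b - g b) * (p - b - q) := by
    simp only [rewardEst, meanReward]; ring
  rw [e1]
  refine (abs_add_three _ _ _).trans ?_
  rw [abs_mul, abs_mul, abs_mul, abs_of_nonneg hG.1, abs_of_nonneg hG0, width]
  have k1 := mul_le_mul_of_nonneg_left h1 hG.1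
  have k0 := mul_le_mul_of_nonneg_left h0 hG0
  have k2 : |G b - g b| * |p - b - q| ≤ e * 3 :=
    mul_le_mul he hpq (abs_nonneg _) ((abs_nonneg _).trans he)
  nlinarith

theorem exists_bound_rewardEst {d : ℕ} (Φ : List (Round d)) (x : Ctx d) {G : ℝ → ℝ}
    (hG : ∀ b, G b ∈ Set.Icc (0 : ℝ) 1) : ∃ K, ∀ b ∈ Bids, rewardEst Φ x G b ≤ K := by
  refine ⟨|thetaHat true Φ ⬝ᵥ x.ofLp| + |thetaHat false Φ ⬝ᵥ x.ofLp|, fun b hb => ?_⟩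
  have h := hG b
  have h1 : G b * (thetaHat true Φ ⬝ᵥ x.ofLp - b) ≤ 1 * |thetaHat true Φ ⬝ᵥ x.ofLp| :=
    (mul_le_mul_of_nonneg_left (by linarith [hb.1, le_abs_self (thetaHat true Φ ⬝ᵥ x.ofLp)])
      h.1).trans (mul_le_mul_of_nonneg_right h.2 (abs_nonneg _))
  have h0 : (1 - G b) * (thetaHat false Φ ⬝ᵥ x.ofLp) ≤ 1 * |thetaHat false Φ ⬝ᵥ x.ofLp| :=
    (mul_le_mul_of_nonneg_left (le_abs_self _) (by linarith [h.2])).trans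
      (mul_le_mul_of_nonneg_right (by linarith [h.1]) (abs_nonneg _))
  rw [rewardEst]
  linarith

/-- The upper confidence bounds need not attain their supremum, as the estimated CDF may be
discontinuous. A bid close enough to the supremum survives, and it can be chosen to beat any
eliminated bid by more than the elimination margin. -/
theorem exists_mem_eliminate {s : ℕ} {r w : ℝ → ℝ} {B : Set ℝ} {K : ℝ}
    (hK : ∀ b ∈ B, r b + w b ≤ K) {b₀ : ℝ} (hb₀ : b₀ ∈ B) :
    ∃ b ∈ eliminate s r w B, b = b₀ ∨ r b₀ + w b₀ + 2 * (1 / 2 : ℝ) ^ s < r b + w b := by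
  by_cases h : b₀ ∈ eliminate s r w B
  · exact ⟨b₀, h, Or.inl rfl⟩
  have h' : ∃ b' ∈ B, r b₀ + w b₀ < r b' + w b' - 2 * (1 / 2 : ℝ) ^ s := by
    by_contra! hc
    exact h ⟨hb₀, hc⟩
  obtain ⟨b', hb', hlt⟩ := h'
  have hbdd : BddAbove ((fun b => r b + w b) '' B) :=
    ⟨K, by rintro _ ⟨b, hb, rfl⟩; exact hK b hb⟩
  have hle : ∀ b ∈ B, r b + w b ≤ sSup ((fun b => r b + w b) '' B) :=
    fun b hb => le_csSup hbdd ⟨b, hb, rfl⟩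
  have hpos : (0 : ℝ) < 2 * (1 / 2 : ℝ) ^ s := by positivity
  have hmax : max (r b₀ + w b₀ + 2 * (1 / 2 : ℝ) ^ s)
      (sSup ((fun b => r b + w b) '' B) - 2 * (1 / 2 : ℝ) ^ s) <
      sSup ((fun b => r b + w b) '' B) :=
    max_lt (by linarith [hle b' hb']) (by linarith)
  obtain ⟨_, ⟨b, hb, rfl⟩, hbs⟩ := exists_lt_of_lt_csSup (Set.Nonempty.image _ ⟨b₀, hb₀⟩) hmax
  have h1 := (le_max_left _ _).trans_lt hbs
  have h2 := (le_max_right _ _).trans_lt hbs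
  exact ⟨b, ⟨hb, fun b'' hb'' => by linarith [hle b'' hb'']⟩, Or.inr h1⟩

section Loop

variable {T d : ℕ} (R : SelectionRule T d) (t : ℕ) (h : Fin t → ℝ × Ctx d)
  (past : List (Round d)) (x : Ctx d) {G : ℝ → ℝ}

theorem stageLoop_mem (hG : ∀ b, G b ∈ Set.Icc (0 : ℝ) 1) (n s : ℕ) {B : Set ℝ} (hB : B ⊆ Bids)
    (hne : B.Nonempty) : (stageLoop R t h past x G n s B).1 ∈ Bids := by
  induction n generalizing s B with
  | zero => simp [stageLoop]
  | succ n ih =>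
    obtain ⟨K, hK⟩ := exists_bound_rewardEst (past.filter fun r => r.stage = s) x hG
    by_cases h1 : ∃ b ∈ B, (1 / 2 : ℝ) ^ s < width T (past.filter fun r => r.stage = s) x G b
    · rw [stageLoop_explore R t h past x G n s B h1]
      exact hB (R.explore_spec _ _ _ _ _ _ h1).1
    by_cases h2 : ∀ b ∈ B, width T (past.filter fun r => r.stage = s) x G b ≤ 1 / √(T : ℝ)
    · rw [stageLoop_exploit R t h past x G n s B h1 h2]
      refine hB (R.exploit_spec _ _ _ _ _ _ hne ⟨K, ?_⟩).1
      rintro _ ⟨b, hb, rfl⟩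
      exact hK b (hB hb)
    · rw [stageLoop_next R t h past x G n s B h1 h2]
      refine ih _ ((Set.sep_subset _ _).trans hB) ?_
      obtain ⟨b₀, hb₀⟩ := hne
      push Not at h1
      obtain ⟨b, hb, -⟩ := exists_mem_eliminate (s := s)
        (fun b hb => add_le_add (hK b (hB hb)) (h1 b hb)) hb₀
      exact ⟨b, hb⟩

/-- Two invariants pass from stage to stage: every bid has a survivor that is worse by at most `6 s
e` (`hbest`), and every survivor is within `8 · 2^{-s} + 6 s e` of every bid (`hgap`). Each stage
adds `6 e`, twice the CDF part of the estimation error. -/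
theorem stageLoop_regret (hG : ∀ b, G b ∈ Set.Icc (0 : ℝ) 1) {f : ℝ → ℝ} {e : ℝ} (he : 0 ≤ e)
    {N : ℕ} (hN : (1 / 2 : ℝ) ^ N ≤ 1 / √(T : ℝ))
    (hconf : ∀ j, 1 ≤ j → j ≤ N → ∀ b ∈ Bids,
      |rewardEst (past.filter fun r => r.stage = j) x G b - f b| ≤
        width T (past.filter fun r => r.stage = j) x G b + 3 * e)
    (n s : ℕ) {B : Set ℝ} (hs : 1 ≤ s) (hsn : s + n = N) (hB : B ⊆ Bids)
    (hne : B.Nonempty) (hbest : ∀ b₀ ∈ Bids, ∃ b ∈ B, f b₀ ≤ f b + 6 * s * e)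
    (hgap : ∀ b ∈ B, ∀ b₀ ∈ Bids, f b₀ - f b ≤ 8 * (1 / 2 : ℝ) ^ s + 6 * s * e)
    (p : ℝ × ℕ) (hp : p = stageLoop R t h past x G (n + 1) s B) {b₀ : ℝ} (hb₀ : b₀ ∈ Bids) :
    (p.2 = 0 ∧ f b₀ - f p.1 ≤ 3 * (1 / √(T : ℝ)) + 6 * (N + 1) * e) ∨
      (1 ≤ p.2 ∧ (1 / 2 : ℝ) ^ p.2 < width T (past.filter fun r => r.stage = p.2) x G p.1 ∧
        f b₀ - f p.1 ≤ 8 * (1 / 2 : ℝ) ^ p.2 + 6 * (N + 1) * e) := by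
  induction n using Nat.strong_induction_on generalizing s B with
  | _ n ih =>
  have hsN : (s : ℝ) ≤ N := by exact_mod_cast (by omega : s ≤ N)
  have hse : 6 * (s : ℝ) * e ≤ 6 * N * e := by gcongr
  have hs0 := hconf s hs (by omega)
  obtain ⟨K, hK⟩ := exists_bound_rewardEst (past.filter fun r => r.stage = s) x hG
  by_cases h1 : ∃ b ∈ B, (1 / 2 : ℝ) ^ s < width T (past.filter fun r => r.stage = s) x G b
  · rw [stageLoop_explore R t h past x G _ s B h1] at hp
    obtain ⟨k1, k2⟩ := R.explore_spec t h x s B _ h1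
    subst hp
    exact Or.inr ⟨hs, k2, (hgap _ k1 b₀ hb₀).trans (by linarith)⟩
  by_cases h2 : ∀ b ∈ B, width T (past.filter fun r => r.stage = s) x G b ≤ 1 / √(T : ℝ)
  · rw [stageLoop_exploit R t h past x G _ s B h1 h2] at hp
    have hbdd : BddAbove (rewardEst (past.filter fun r => r.stage = s) x G '' B) := by
      refine ⟨K, ?_⟩
      rintro _ ⟨b, hb, rfl⟩
      exact hK b (hB hb)
    obtain ⟨k1, k2⟩ := R.exploit_spec t h x s B _ hne hbdd
    obtain ⟨b', hb', hle⟩ := hbest b₀ hb₀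
    subst hp
    refine Or.inl ⟨rfl, ?_⟩
    have i1 := (abs_le.1 (hs0 b' (hB hb'))).1
    have i2 := (abs_le.1 (hs0 _ (hB k1))).2
    have i3 := k2 b' hb'
    have i4 := h2 b' hb'
    have i5 := h2 _ k1
    simp only
    linarith
  · rw [stageLoop_next R t h past x G _ s B h1 h2] at hp
    push Not at h1
    -- At the last stage `2^{-N} ≤ 1 / √T`, so small widths already force the exploitation exit and
    -- the loop cannot go on.
    obtain ⟨m, rfl⟩ : ∃ m, n = m + 1 := by
      refine Nat.exists_eq_succ_of_ne_zero fun hn => h2 fun b hb => ?_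
      rw [hn, add_zero] at hsn
      exact (h1 b hb).trans (hsn ▸ hN)
    have hsub : eliminate s (rewardEst (past.filter fun r => r.stage = s) x G)
        (width T (past.filter fun r => r.stage = s) x G) B ⊆ B := Set.sep_subset _ _
    have hmem := fun {b₁ : ℝ} (hb₁ : b₁ ∈ B) => exists_mem_eliminate (s := s)
      (fun b hb => add_le_add (hK b (hB hb)) (h1 b hb)) hb₁
    refine ih m (Nat.lt_succ_self m) (s + 1) (by omega) (by omega) (hsub.trans hB) ?_ ?_ ?_ hp
    · obtain ⟨b₁, hb₁⟩ := hne
      obtain ⟨b, hb, -⟩ := hmem hb₁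
      exact ⟨b, hb⟩
    · intro b₀ hb₀
      obtain ⟨b₁, hb₁, hle⟩ := hbest b₀ hb₀
      obtain ⟨b, hb, hor⟩ := hmem hb₁
      refine ⟨b, hb, ?_⟩
      push_cast
      rcases hor with rfl | hlt
      · linarith
      -- The lead of `2 · 2^{-s}` in upper confidence bounds pays for twice the width of `b`.
      · have i1 := (abs_le.1 (hs0 _ (hB hb₁))).1
        have i2 := (abs_le.1 (hs0 _ (hB (hsub hb)))).2
        have i3 := h1 _ (hsub hb)
        linarith
    -- The elimination margin `2 · 2^{-s}` and twice the width of `b` sum to at most `4 · 2^{-s} = 8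
    -- · 2^{-(s+1)}`.
    · intro b hb b₀ hb₀
      obtain ⟨b₁, hb₁, hle⟩ := hbest b₀ hb₀
      have i1 := (abs_le.1 (hs0 _ (hB hb₁))).1
      have i2 := (abs_le.1 (hs0 _ (hB (hsub hb)))).2
      have i3 := h1 _ (hsub hb)
      have i4 := hb.2 b₁ hb₁
      push_cast
      rw [pow_succ]
      linarith

end Loop

/-! ### Independence and concentration -/

theorem iIndepFun_bool {Ω β : Type*} [MeasurableSpace Ω] [MeasurableSpace β] {μ : Measure Ω}
    [IsProbabilityMeasure μ] {f : Bool → Ω → β} (h : IndepFun (f true) (f false) μ) :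
    iIndepFun f μ := by
  rw [iIndepFun_iff_measure_inter_preimage_eq_mul]
  intro S sets hS
  by_cases h1 : true ∈ S <;> by_cases h0 : false ∈ S
  · have : S = {true, false} := by ext b; cases b <;> simp [h1, h0]
    subst this
    rw [Finset.set_biInter_insert, Finset.set_biInter_singleton, Finset.prod_insert (by simp),
      Finset.prod_singleton]
    exact h.measure_inter_preimage_eq_mul _ _ (hS true h1) (hS false h0)
  · have : S = {true} := by ext b; cases b <;> simp [h1, h0]
    subst this
    simp
  · have : S = {false} := by ext b; cases b <;> simp [h1, h0]
    subst this
    simp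
  · have : S = ∅ := by ext b; cases b <;> simp [h1, h0]
    subst this
    simp

/-- The highest other bid (`i = true`) and the pair of potential outcomes (`i = false`). -/
def blocks {Ω : Type*} (M v₀ v₁ : ℕ → Ω → ℝ) (t : ℕ) (i : Bool) (ω : Ω) : ℝ × ℝ :=
  if i then (M t ω, M t ω) else (v₀ t ω, v₁ t ω)

/-- The trajectory up to time `T`, with the potential outcomes erased in the rounds of `W`. -/
def eraseOutcomes (T : ℕ) (W : Finset ℕ) (z : Trajectory) : Trajectory := fun τ =>
  if τ < T then (if τ ∈ W then ((z τ).1, 0, 0) else z τ) else 0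

/-- The potential outcomes in the rounds of `W` up to time `T`. -/
def outcomesOn (T : ℕ) (W : Finset ℕ) (z : Trajectory) : ℕ → ℝ × ℝ := fun τ =>
  if τ < T ∧ τ ∈ W then (z τ).2 else 0

/-- The trajectory before time `t`. -/
def truncate (t : ℕ) (z : Trajectory) : Trajectory := fun τ => if τ < t then z τ else 0

/-! ### Independence in the model and Hoeffding's inequality for a fixed set of rounds. -/

section Model

variable {Ω : Type*} [MeasurableSpace Ω] {μ : Measure Ω} {L : ℝ≥0} {T d : ℕ} {x : ℕ → Ctx d} {θ₀ θ₁ : Ctx d} {M v₀ v₁ : ℕ → Ω → ℝ}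

theorem measurable_blocks (H : LinearPotentialOutcomes μ T L x θ₀ θ₁ M v₀ v₁) (t : ℕ) (i : Bool) :
    Measurable (blocks M v₀ v₁ t i) := by
  have h0 := H.measurable_v₀ t
  have h1 := H.measurable_v₁ t
  have h2 := H.measurable_M t
  cases i
  · exact h0.prodMk h1
  · exact h2.prodMk h2

theorem measurable_trajectory (H : LinearPotentialOutcomes μ T L x θ₀ θ₁ M v₀ v₁) :
    Measurable (trajectory M v₀ v₁) :=
  measurable_pi_lambda _ fun t =>
    (H.measurable_M t).prodMk ((H.measurable_v₀ t).prodMk (H.measurable_v₁ t))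

/-- The parameter of the potential outcome on winning (`i = true`) or losing (`i = false`). -/
def param (θ₀ θ₁ : Ctx d) (i : Bool) : Ctx d := if i then θ₁ else θ₀

theorem inner_eq_dotProduct (θ y : Ctx d) : inner ℝ θ y = θ.ofLp ⬝ᵥ y.ofLp := by
  rw [EuclideanSpace.inner_eq_star_dotProduct, dotProduct_comm]
  simp

theorem dotProduct_self_eq (y : Ctx d) : y.ofLp ⬝ᵥ y.ofLp = ‖y‖ ^ 2 := by
  rw [← inner_eq_dotProduct, real_inner_self_eq_norm_sq]

theorem param_dotProduct_self (H : LinearPotentialOutcomes μ T L x θ₀ θ₁ M v₀ v₁) (i : Bool) :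
    (param θ₀ θ₁ i).ofLp ⬝ᵥ (param θ₀ θ₁ i).ofLp ≤ 1 := by
  rw [dotProduct_self_eq]
  cases i
  · exact pow_le_one₀ (norm_nonneg _) H.norm_θ₀
  · exact pow_le_one₀ (norm_nonneg _) H.norm_θ₁

theorem vec_dotProduct_self (H : LinearPotentialOutcomes μ T L x θ₀ θ₁ M v₀ v₁) {t : ℕ}
    (ht : t < T) : vec x t ⬝ᵥ vec x t ≤ 1 := by
  rw [vec, dotProduct_self_eq]
  exact pow_le_one₀ (norm_nonneg _) (H.norm_ctx t ht)

theorem measurable_potential (i : Bool) : Measurable (potential i) := by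
  cases i
  · exact measurable_snd.fst
  · exact measurable_snd.snd

theorem potential_mem (H : LinearPotentialOutcomes μ T L x θ₀ θ₁ M v₀ v₁) (i : Bool) {t : ℕ}
    (ht : t < T) : ∀ᵐ ω ∂μ, potential i (trajectory M v₀ v₁ ω t) ∈ Set.Icc (0 : ℝ) 1 := by
  cases i
  · exact H.v₀_mem t ht
  · exact H.v₁_mem t ht

theorem integral_potential (H : LinearPotentialOutcomes μ T L x θ₀ θ₁ M v₀ v₁) (i : Bool) {t : ℕ}
    (ht : t < T) : ∫ ω, potential i (trajectory M v₀ v₁ ω t) ∂μ =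
      (param θ₀ θ₁ i).ofLp ⬝ᵥ vec x t := by
  cases i
  · exact (H.mean_v₀ t ht).trans (inner_eq_dotProduct _ _)
  · exact (H.mean_v₁ t ht).trans (inner_eq_dotProduct _ _)

theorem indepFun_truncate (H : LinearPotentialOutcomes μ T L x θ₀ θ₁ M v₀ v₁) {t : ℕ} (ht : t < T) :
    IndepFun (fun ω => truncate t (trajectory M v₀ v₁ ω))
      (fun ω => trajectory M v₀ v₁ ω t) μ := by
  classical
  let A : Finset (Fin T) := Finset.univ.filter fun p => p.1 < t
  have hAB : Disjoint A {⟨t, ht⟩} := by simp [A]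
  have h := H.indep_time.indepFun_finset A {⟨t, ht⟩} hAB fun p =>
    (H.measurable_M p).prodMk ((H.measurable_v₀ p).prodMk (H.measurable_v₁ p))
  let φ : (A → ℝ × ℝ × ℝ) → Trajectory := fun u τ =>
    if hτ : τ < t then u ⟨⟨τ, hτ.trans ht⟩, by simp [A, hτ]⟩ else 0
  have hφ : Measurable φ := by
    refine measurable_pi_lambda _ fun τ => ?_
    by_cases hτ : τ < t
    · simp only [φ, hτ, dite_true]
      fun_prop
    · simp only [φ, hτ, dite_false]
      fun_prop
  have hψ : Measurable fun u : (({⟨t, ht⟩} : Finset (Fin T)) → ℝ × ℝ × ℝ) =>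
      u ⟨⟨t, ht⟩, by simp⟩ := by fun_prop
  have h2 := h.comp hφ hψ
  convert h2 using 1
  · funext ω τ
    simp only [Function.comp, φ, truncate, trajectory]
    split_ifs <;> rfl
  · rfl

variable [IsProbabilityMeasure μ]

/-- Independence over time and unconfoundedness within a round combine into mutual independence of
all blocks. Repeating `M` in its block gives both kinds of block the same type. -/
theorem iIndepFun_blocks (H : LinearPotentialOutcomes μ T L x θ₀ θ₁ M v₀ v₁) :
    iIndepFun (fun (p : Fin T × Bool) ω => blocks M v₀ v₁ p.1 p.2 ω) μ := by
  refine iIndepFun_uncurry' (X := fun (t : Fin T) i => blocks M v₀ v₁ t i)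
    (fun t i => measurable_blocks H t i) ?_ fun t => ?_
  · have hm : ∀ _ : Fin T, Measurable fun (p : ℝ × ℝ × ℝ) (i : Bool) =>
        if i then (p.1, p.1) else (p.2.1, p.2.2) := by
      intro _
      refine measurable_pi_lambda _ fun i => ?_
      cases i <;> simp <;> fun_prop
    exact H.indep_time.comp _ hm
  · refine iIndepFun_bool ?_
    have h := (H.unconfounded t t.2).symm
    have hm : Measurable fun m : ℝ => (m, m) := by fun_prop
    exact h.comp hm measurable_id

/-- The two sides are functions of disjoint families of blocks: the outcome blocks of `W`, and all
the others. -/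
theorem indepFun_eraseOutcomes (H : LinearPotentialOutcomes μ T L x θ₀ θ₁ M v₀ v₁)
    (W : Finset ℕ) :
    IndepFun (fun ω => eraseOutcomes T W (trajectory M v₀ v₁ ω))
      (fun ω => outcomesOn T W (trajectory M v₀ v₁ ω)) μ := by
  classical
  let A : Finset (Fin T × Bool) := Finset.univ.filter fun p => ¬ (p.2 = false ∧ p.1.1 ∈ W)
  let B : Finset (Fin T × Bool) := Finset.univ.filter fun p => p.2 = false ∧ p.1.1 ∈ W
  have hAB : Disjoint A B := (Finset.disjoint_filter_filter_not _ _ _).symm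
  have h := (iIndepFun_blocks H).indepFun_finset A B hAB fun p => measurable_blocks H p.1 p.2
  let φ : (A → ℝ × ℝ) → Trajectory := fun u τ =>
    if hτ : τ < T then
      ((u ⟨(⟨τ, hτ⟩, true), by simp [A]⟩).1,
        if hW : τ ∈ W then 0 else u ⟨(⟨τ, hτ⟩, false), by simp [A, hW]⟩)
    else 0
  let ψ : (B → ℝ × ℝ) → ℕ → ℝ × ℝ := fun u τ =>
    if hτ : τ < T ∧ τ ∈ W then u ⟨(⟨τ, hτ.1⟩, false), by simp [B, hτ.2]⟩ else 0
  have hφ : Measurable φ := by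
    refine measurable_pi_lambda _ fun τ => ?_
    by_cases hτ : τ < T
    · by_cases hW : τ ∈ W
      · simp only [φ, hτ, hW, dite_true]
        fun_prop
      · simp only [φ, hτ, hW, dite_true, dite_false]
        fun_prop
    · simp only [φ, hτ, dite_false]
      fun_prop
  have hψ : Measurable ψ := by
    refine measurable_pi_lambda _ fun τ => ?_
    by_cases hτ : τ < T ∧ τ ∈ W
    · simp only [ψ, hτ, and_self, dite_true]
      fun_prop
    · simp only [ψ, hτ, dite_false]
      fun_prop
  have h2 := h.comp hφ hψ
  convert h2 using 1
  · funext ω τ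
    simp only [Function.comp, φ, eraseOutcomes, trajectory, blocks]
    split_ifs <;> simp_all
  · funext ω τ
    simp only [Function.comp, ψ, outcomesOn, trajectory, blocks]
    split_ifs <;> simp_all

/-- The weighted noise of the potential outcomes in the rounds of `W`. -/
def noise (x : ℕ → Ctx d) (θ : Ctx d) (i : Bool) (c : ℕ → ℝ) (W : Finset ℕ) (z : Trajectory) : ℝ :=
  ∑ τ ∈ W, c τ * (potential i (z τ) - θ.ofLp ⬝ᵥ vec x τ)

theorem measureReal_noise_ge_le (H : LinearPotentialOutcomes μ T L x θ₀ θ₁ M v₀ v₁) (i : Bool)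
    (c : ℕ → ℝ) {W : Finset ℕ} (hW : W ⊆ Finset.range T) {a : ℝ} (ha : 0 ≤ a) :
    μ.real {ω | a ≤ noise x (param θ₀ θ₁ i) i c W (trajectory M v₀ v₁ ω)} ≤
      Real.exp (-2 * a ^ 2 / ∑ τ ∈ W, c τ ^ 2) := by
  classical
  -- Extending the weights by zero turns the sum over `W` into a sum over `Fin T`, the index type of
  -- the independence hypothesis.
  let c' : ℕ → ℝ := fun τ => if τ ∈ W then c τ else 0
  have hsum : ∀ f : ℕ → ℝ, ∑ τ ∈ W, f τ = ∑ τ : Fin T, if τ.1 ∈ W then f τ else 0 := by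
    intro f
    rw [Fin.sum_univ_eq_sum_range (fun τ => if τ ∈ W then f τ else 0), ← Finset.sum_filter,
      Finset.filter_mem_eq_inter, Finset.inter_eq_right.2 hW]
  let X : Fin T → Ω → ℝ := fun τ ω =>
    c' τ * (potential i (trajectory M v₀ v₁ ω τ) - (param θ₀ θ₁ i).ofLp ⬝ᵥ vec x τ)
  have hX : iIndepFun X μ := by
    have hm : ∀ τ : Fin T, Measurable fun p : ℝ × ℝ × ℝ =>
        c' τ * (potential i p - (param θ₀ θ₁ i).ofLp ⬝ᵥ vec x τ) := fun τ =>
      ((measurable_potential i).sub_const _).const_mul _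
    exact H.indep_time.comp _ hm
  let k : Fin T → ℝ≥0 := fun τ => ⟨c' τ ^ 2, sq_nonneg _⟩
  let q : Fin T → ℝ≥0 := fun τ => k τ * (‖(1 : ℝ) - 0‖₊ / 2) ^ 2
  have hq : ∀ τ, (q τ : ℝ) = c' τ ^ 2 / 4 := by
    intro τ
    have : (q τ : ℝ) = c' τ ^ 2 * (‖(1 : ℝ) - 0‖ / 2) ^ 2 := rfl
    rw [this]
    norm_num
    ring
  have hsub : ∀ τ ∈ (Finset.univ : Finset (Fin T)), HasSubgaussianMGF (X τ) (q τ) μ := by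
    intro τ _
    have h := hasSubgaussianMGF_of_mem_Icc (μ := μ) (a := 0) (b := 1)
      (X := fun ω => potential i (trajectory M v₀ v₁ ω τ))
      (((measurable_potential i).comp ((measurable_pi_apply _).comp
        (measurable_trajectory H))).aemeasurable) (potential_mem H i τ.2)
    rw [integral_potential H i τ.2] at h
    exact h.const_mul (c' τ)
  have key := HasSubgaussianMGF.measure_sum_ge_le_of_iIndepFun hX hsub ha
  have e1 : ∀ ω, ∑ τ, X τ ω = noise x (param θ₀ θ₁ i) i c W (trajectory M v₀ v₁ ω) := by
    intro ω
    rw [noise, hsum]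
    refine Finset.sum_congr rfl fun τ _ => ?_
    simp only [X, c']
    split_ifs <;> simp
  simp only [e1] at key
  refine key.trans (le_of_eq ?_)
  congr 1
  have e2 : ((∑ τ : Fin T, q τ : ℝ≥0) : ℝ) = (∑ τ ∈ W, c τ ^ 2) / 4 := by
    rw [hsum, NNReal.coe_sum, Finset.sum_div]
    refine Finset.sum_congr rfl fun τ _ => ?_
    rw [hq]
    simp only [c']
    split_ifs <;> simp
  rw [e2]
  by_cases h0 : ∑ τ ∈ W, c τ ^ 2 = 0
  · simp [h0]
  · field_simp
    ring

theorem noise_neg (x : ℕ → Ctx d) (θ : Ctx d) (i : Bool) (c : ℕ → ℝ) (W : Finset ℕ)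
    (z : Trajectory) : noise x θ i (fun τ => -c τ) W z = -noise x θ i c W z := by
  simp [noise]

theorem measureReal_abs_noise_gt_le (H : LinearPotentialOutcomes μ T L x θ₀ θ₁ M v₀ v₁) (i : Bool)
    (c : ℕ → ℝ) {W : Finset ℕ} (hW : W ⊆ Finset.range T) {β K : ℝ} (hβ : 0 ≤ β) (hK : 0 ≤ K)
    (hc : ∑ τ ∈ W, c τ ^ 2 ≤ K ^ 2) :
    μ.real {ω | β * K < |noise x (param θ₀ θ₁ i) i c W (trajectory M v₀ v₁ ω)|} ≤
      2 * Real.exp (-2 * β ^ 2) := by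
  have hnn : 0 ≤ ∑ τ ∈ W, c τ ^ 2 := Finset.sum_nonneg fun _ _ => sq_nonneg _
  have ha : 0 ≤ β * K := mul_nonneg hβ hK
  rcases hnn.eq_or_lt with h0 | hpos
  -- With zero weights the exponent is a division by zero, which Lean evaluates to `0`, and the
  -- Hoeffding bound is trivial. The noise vanishes in this case.
  · have hc0 : ∀ τ ∈ W, c τ = 0 := by
      intro τ hτ
      have := (Finset.sum_eq_zero_iff_of_nonneg fun _ _ => sq_nonneg _).1 h0.symm τ hτ
      exact pow_eq_zero_iff (two_ne_zero) |>.1 this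
    have hz : ∀ z, noise x (param θ₀ θ₁ i) i c W z = 0 := fun z =>
      Finset.sum_eq_zero fun τ hτ => by rw [hc0 τ hτ, zero_mul]
    have : {ω | β * K < |noise x (param θ₀ θ₁ i) i c W (trajectory M v₀ v₁ ω)|} = ∅ := by
      ext ω
      simp [hz, ha]
    rw [this, measureReal_empty]
    positivity
  · have hexp : Real.exp (-2 * (β * K) ^ 2 / ∑ τ ∈ W, c τ ^ 2) ≤ Real.exp (-2 * β ^ 2) := by
      rw [Real.exp_le_exp, div_le_iff₀ hpos]
      nlinarith [mul_le_mul_of_nonneg_left hc (sq_nonneg β)]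
    have h1 := (measureReal_noise_ge_le H i c hW ha).trans hexp
    have h2 := measureReal_noise_ge_le H i (fun τ => -c τ) hW ha
    simp only [neg_sq] at h2
    have h2 := h2.trans hexp
    calc μ.real {ω | β * K < |noise x (param θ₀ θ₁ i) i c W (trajectory M v₀ v₁ ω)|}
        ≤ μ.real ({ω | β * K ≤ noise x (param θ₀ θ₁ i) i c W (trajectory M v₀ v₁ ω)} ∪
          {ω | β * K ≤ noise x (param θ₀ θ₁ i) i (fun τ => -c τ) W (trajectory M v₀ v₁ ω)}) := by
          refine measureReal_mono fun ω hω => ?_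
          rcases lt_abs.1 (Set.mem_ofPred_eq ▸ hω) with h | h
          · exact Or.inl h.le
          · right
            rw [Set.mem_ofPred_eq, noise_neg]
            exact h.le
      _ ≤ _ := measureReal_union_le _ _
      _ ≤ 2 * Real.exp (-2 * β ^ 2) := by linarith

end Model

/-! ### Confidence bounds over the random index sets. -/

section Concentration

variable {T d : ℕ} {O : CDFOracle d} {R : SelectionRule T d} {x : ℕ → Ctx d}

theorem measurableSet_mem_stageSet
    (hdec : ∀ t < T, Measurable fun z : Trajectory => decision O R x z t) (s : ℕ) (i : Bool) {t : ℕ}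
    (ht : t ≤ T) (τ : ℕ) : MeasurableSet {z | τ ∈ stageSet O R x z s i t} := by
  simp only [mem_stageSet]
  by_cases hτ : τ < t
  · have hd := hdec τ (hτ.trans_le ht)
    simp only [hτ, true_and]
    refine MeasurableSet.inter (hd.snd (measurableSet_singleton s)) ?_
    have h1 : MeasurableSet {z : Trajectory | (z τ).1 ≤ (decision O R x z τ).1} :=
      measurableSet_le (measurable_pi_apply τ).fst hd.fst
    cases i
    · simp only [decide_eq_false_iff_not]
      exact h1.compl
    · simp only [decide_eq_true_eq]
      exact h1
  · simp [hτ]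

theorem measurableSet_stageSet_eq
    (hdec : ∀ t < T, Measurable fun z : Trajectory => decision O R x z t) (s : ℕ) (i : Bool) {t : ℕ}
    (ht : t ≤ T) (W : Finset ℕ) : MeasurableSet {z | stageSet O R x z s i t = W} := by
  simp only [Finset.ext_iff, Set.ofPred_forall]
  refine MeasurableSet.iInter fun τ => ?_
  by_cases hτ : τ ∈ W
  · simpa [hτ] using measurableSet_mem_stageSet hdec s i ht τ
  · simp only [hτ, iff_false]
    exact (measurableSet_mem_stageSet hdec s i ht τ).compl

theorem measurable_comp_stageSet
    (hdec : ∀ t < T, Measurable fun z : Trajectory => decision O R x z t) (s : ℕ) (i : Bool) {t : ℕ}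
    (ht : t ≤ T) (f : Finset ℕ → ℝ) : Measurable fun z => f (stageSet O R x z s i t) := by
  -- There are countably many finite sets of rounds, so measurability of the fibres is enough.
  let : MeasurableSpace (Finset ℕ) := ⊤
  have h : Measurable fun z => stageSet O R x z s i t :=
    measurable_to_countable' fun W => measurableSet_stageSet_eq hdec s i ht W
  exact (measurable_from_top (f := f)).comp h

/-- Erasing the outcomes in `W` alters nothing outside the set as soon as either trajectory has
index set `W`, so invariance applies in both directions. -/
theorem stageSet_eraseOutcomes {s t : ℕ} {i : Bool} (hs : 1 ≤ s) (ht : t ≤ T) (W : Finset ℕ)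
    (z : Trajectory) : stageSet O R x z s i t = W ↔
      stageSet O R x (eraseOutcomes T W z) s i t = W := by
  have hM : ∀ τ < t, (z τ).1 = (eraseOutcomes T W z τ).1 := by
    intro τ hτ
    rw [eraseOutcomes, if_pos (hτ.trans_le ht)]
    split_ifs <;> rfl
  have hv : ∀ τ < t, τ ∉ W → z τ = eraseOutcomes T W z τ := by
    intro τ hτ hW
    rw [eraseOutcomes, if_pos (hτ.trans_le ht), if_neg hW]
  constructor
  · intro h
    rw [← stageSet_eq_of_agree O R x hs hM fun τ hτ hW => hv τ hτ (h ▸ hW), h]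
  · intro h
    rw [← stageSet_eq_of_agree O R x (z := eraseOutcomes T W z) hs (fun τ hτ => (hM τ hτ).symm)
      fun τ hτ hW => (hv τ hτ (h ▸ hW)).symm, h]

theorem noise_eq_outcomesOn {W : Finset ℕ} (hW : W ⊆ Finset.range T) (θ : Ctx d) (i : Bool)
    (c : ℕ → ℝ) (z : Trajectory) :
    noise x θ i c W z = noise x θ i c W fun τ => (0, outcomesOn T W z τ) := by
  refine Finset.sum_congr rfl fun τ hτ => ?_
  have h : outcomesOn T W z τ = (z τ).2 := if_pos ⟨Finset.mem_range.1 (hW hτ), hτ⟩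
  simp only [h]
  cases i <;> rfl

theorem measurable_noise (θ : Ctx d) (i : Bool) (c : ℕ → ℝ) (W : Finset ℕ) :
    Measurable (noise x θ i c W) := by
  refine Finset.measurable_sum _ fun τ _ => ?_
  exact (((measurable_potential i).comp (measurable_pi_apply τ)).sub_const _).const_mul _

variable {Ω : Type*} [MeasurableSpace Ω] {μ : Measure Ω} [IsProbabilityMeasure μ]
  {L : ℝ≥0} {θ₀ θ₁ : Ctx d} {M v₀ v₁ : ℕ → Ω → ℝ}

/-- A union bound over the values of a random index `S`, conditionally on which the event `P` has
probability at most `δ`. -/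
theorem measureReal_random_index_le {ι : Type*} (S : Ω → ι) (P : ι → Set Ω) (A : Finset ι) {δ : ℝ}
    (hδ : 0 ≤ δ) (hA : ∀ ω, S ω ∈ A) (hm : ∀ W, MeasurableSet {ω | S ω = W})
    (hle : ∀ W ∈ A, μ.real ({ω | S ω = W} ∩ P W) ≤ μ.real {ω | S ω = W} * δ) :
    μ.real {ω | ω ∈ P (S ω)} ≤ δ := by
  calc μ.real {ω | ω ∈ P (S ω)} ≤ μ.real (⋃ W ∈ A, {ω | S ω = W} ∩ P W) := by
        refine measureReal_mono (fun ω hω => ?_) (measure_ne_top _ _)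
        simp only [Set.mem_iUnion]
        exact ⟨S ω, hA ω, rfl, hω⟩
    _ ≤ ∑ W ∈ A, μ.real ({ω | S ω = W} ∩ P W) := measureReal_biUnion_finset_le _ _
    _ ≤ ∑ W ∈ A, μ.real {ω | S ω = W} * δ := Finset.sum_le_sum hle
    _ = μ.real (⋃ W ∈ A, {ω | S ω = W}) * δ := by
        rw [measureReal_biUnion_finset _ fun W _ => hm W, Finset.sum_mul]
        intro W _ W' _ hne
        refine Set.disjoint_left.2 fun ω h1 h2 => hne ?_
        rw [Set.mem_ofPred_eq] at h1 h2
        rw [← h1, h2]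
    _ ≤ 1 * δ := by
        gcongr
        exact measureReal_le_one
    _ = _ := one_mul _

/-- The first event is a function of the trajectory with the outcomes in `W` erased, the second a
function of those outcomes. -/
theorem measureReal_stageSet_inter_noise (H : LinearPotentialOutcomes μ T L x θ₀ θ₁ M v₀ v₁)
    (hdec : ∀ t < T, Measurable fun z : Trajectory => decision O R x z t) {s t : ℕ} (i : Bool)
    (hs : 1 ≤ s) (ht : t ≤ T) {W : Finset ℕ} (hW : W ⊆ Finset.range T) (θ : Ctx d) (c : ℕ → ℝ)
    (a : ℝ) :
    μ.real ({ω | stageSet O R x (trajectory M v₀ v₁ ω) s i t = W} ∩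
        {ω | a < |noise x θ i c W (trajectory M v₀ v₁ ω)|}) =
      μ.real {ω | stageSet O R x (trajectory M v₀ v₁ ω) s i t = W} *
        μ.real {ω | a < |noise x θ i c W (trajectory M v₀ v₁ ω)|} := by
  have hE : {ω | stageSet O R x (trajectory M v₀ v₁ ω) s i t = W} =
      (fun ω => eraseOutcomes T W (trajectory M v₀ v₁ ω)) ⁻¹'
        {z | stageSet O R x z s i t = W} := by
    ext ω
    rw [Set.mem_preimage, Set.mem_ofPred_eq, Set.mem_ofPred_eq]
    exact stageSet_eraseOutcomes hs ht W _
  have hF : {ω | a < |noise x θ i c W (trajectory M v₀ v₁ ω)|} =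
      (fun ω => outcomesOn T W (trajectory M v₀ v₁ ω)) ⁻¹'
        {o | a < |noise x θ i c W fun τ => (0, o τ)|} := by
    ext ω
    rw [Set.mem_preimage, Set.mem_ofPred_eq, Set.mem_ofPred_eq, noise_eq_outcomesOn hW]
  have hmF : MeasurableSet {o : ℕ → ℝ × ℝ | a < |noise x θ i c W fun τ => (0, o τ)|} := by
    have h1 : Measurable fun o : ℕ → ℝ × ℝ => ((fun τ => (0, o τ)) : Trajectory) :=
      measurable_pi_lambda _ fun τ => measurable_const.prodMk (measurable_pi_apply τ)
    exact measurableSet_lt measurable_const ((measurable_noise _ i c W).comp h1).abs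
  have h := (indepFun_eraseOutcomes H W).measure_inter_preimage_eq_mul _ _
    (measurableSet_stageSet_eq hdec s i ht W) hmF
  rw [← hE, ← hF] at h
  rw [Measure.real, h, ENNReal.toReal_mul]
  rfl

/-- Hoeffding's inequality for the random index set of stage `s`, whose outcomes are not used to
form it. -/
theorem measureReal_stage_noise_le (H : LinearPotentialOutcomes μ T L x θ₀ θ₁ M v₀ v₁)
    (hdec : ∀ t < T, Measurable fun z : Trajectory => decision O R x z t) {s t : ℕ} (i : Bool)
    (hs : 1 ≤ s) (ht : t ≤ T) (c : Finset ℕ → ℕ → ℝ) (K : Finset ℕ → ℝ) (hK : ∀ W, 0 ≤ K W)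
    (hc : ∀ W, ∑ τ ∈ W, c W τ ^ 2 ≤ K W ^ 2) {β : ℝ} (hβ : 0 ≤ β) :
    μ.real {ω | β * K (stageSet O R x (trajectory M v₀ v₁ ω) s i t) <
      |noise x (param θ₀ θ₁ i) i (c (stageSet O R x (trajectory M v₀ v₁ ω) s i t))
        (stageSet O R x (trajectory M v₀ v₁ ω) s i t) (trajectory M v₀ v₁ ω)|} ≤
      2 * Real.exp (-2 * β ^ 2) := by
  have hm : ∀ W, MeasurableSet {ω | stageSet O R x (trajectory M v₀ v₁ ω) s i t = W} := fun W =>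
    measurable_trajectory H (measurableSet_stageSet_eq hdec s i ht W)
  refine measureReal_random_index_le (fun ω => stageSet O R x (trajectory M v₀ v₁ ω) s i t)
    (fun W => {ω | β * K W < |noise x (param θ₀ θ₁ i) i (c W) W (trajectory M v₀ v₁ ω)|})
    (Finset.range t).powerset (by positivity)
    (fun ω => Finset.mem_powerset.2 (stageSet_subset O R x _ s i t)) hm fun W hW => ?_
  have hWT : W ⊆ Finset.range T := (Finset.mem_powerset.1 hW).trans (Finset.range_mono ht)
  rw [measureReal_stageSet_inter_noise H hdec i hs ht hWT]
  exact mul_le_mul_of_nonneg_left (measureReal_abs_noise_gt_le H i (c W) hWT hβ (hK W) (hc W))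
    measureReal_nonneg

theorem thetaHat_stageRounds_sub (z : Trajectory) (s t : ℕ) (i : Bool) (θ y : Ctx d) :
    thetaHat i (stageRounds O R x z s t) ⬝ᵥ y.ofLp - θ.ofLp ⬝ᵥ y.ofLp =
      noise x θ i (fun τ => y.ofLp ⬝ᵥ
        (ridge (vec x) (stageSet O R x z s i t))⁻¹.mulVec (vec x τ)) (stageSet O R x z s i t) z -
        y.ofLp ⬝ᵥ (ridge (vec x) (stageSet O R x z s i t))⁻¹.mulVec θ.ofLp := by
  rw [thetaHat, gram_stageRounds, moment_stageRounds, ridge_estimate_sub]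
  rfl

/-- The estimates of stage `s` in round `t` are within their confidence widths. -/
def StageAccurate (O : CDFOracle d) (R : SelectionRule T d) (x : ℕ → Ctx d) (θ₀ θ₁ : Ctx d)
    (s t : ℕ) (i : Bool) (z : Trajectory) : Prop :=
  |thetaHat i (stageRounds O R x z s t) ⬝ᵥ (x t).ofLp -
      (param θ₀ θ₁ i).ofLp ⬝ᵥ (x t).ofLp| ≤
    (√(Real.log (2 * T)) + 1) * gramNorm i (stageRounds O R x z s t) (x t)

/-- The noise stays below `β` times the weighted norm up to probability `2 exp (-2 β²) = 2 / (2T)²`,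
and the bias is at most one further weighted norm. -/
theorem measureReal_not_stageAccurate_le (H : LinearPotentialOutcomes μ T L x θ₀ θ₁ M v₀ v₁)
    (hdec : ∀ t < T, Measurable fun z : Trajectory => decision O R x z t) (hT : 2 ≤ T) {s t : ℕ}
    (i : Bool) (hs : 1 ≤ s) (ht : t < T) :
    μ.real {ω | ¬ StageAccurate O R x θ₀ θ₁ s t i (trajectory M v₀ v₁ ω)} ≤
      1 / (2 * (T : ℝ) ^ 2) := by
  have hT' : (2 : ℝ) ≤ T := by exact_mod_cast hT
  have hlog : 0 ≤ Real.log (2 * T) := Real.log_nonneg (by linarith)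
  have h := measureReal_stage_noise_le (O := O) (R := R) H hdec i hs ht.le
    (fun W τ => (x t).ofLp ⬝ᵥ (ridge (vec x) W)⁻¹.mulVec (vec x τ))
    (fun W => √(ridgeForm (vec x) W (x t).ofLp)) (fun W => Real.sqrt_nonneg _)
    (fun W => by
      rw [Real.sq_sqrt (ridgeForm_nonneg _ _ _)]
      exact sum_sq_le_ridgeForm _ _ _) (Real.sqrt_nonneg (Real.log (2 * T)))
  have hexp : 2 * Real.exp (-2 * √(Real.log (2 * T)) ^ 2) = 1 / (2 * (T : ℝ) ^ 2) := by
    rw [Real.sq_sqrt hlog, show -2 * Real.log (2 * T) = -(Real.log (2 * T) + Real.log (2 * T)) by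
      ring, Real.exp_neg, Real.exp_add, Real.exp_log (by linarith)]
    field_simp
  rw [hexp] at h
  refine (measureReal_mono fun ω hω => ?_).trans h
  by_contra hle
  refine hω ?_
  rw [Set.mem_ofPred_eq, not_lt] at hle
  rw [StageAccurate, thetaHat_stageRounds_sub, gramNorm_stageRounds]
  have hb := abs_dotProduct_inv_le (vec x)
    (stageSet O R x (trajectory M v₀ v₁ ω) s i t) (x t).ofLp _ (param_dotProduct_self H i)
  refine (abs_sub _ _).trans ?_
  linarith

end Concentration

/-! ### Elliptical potential -/

section Potential

variable {T d : ℕ} {O : CDFOracle d} {R : SelectionRule T d} {x : ℕ → Ctx d}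

/-- The log-determinant increments telescope along the rounds that join the set. -/
theorem sum_ridgeForm_stageSet_le (z : Trajectory) (s : ℕ) (i : Bool) {t : ℕ}
    (hx : ∀ τ < t, vec x τ ⬝ᵥ vec x τ ≤ 1) :
    ∑ τ ∈ stageSet O R x z s i t, ridgeForm (vec x) (stageSet O R x z s i τ) (vec x τ) ≤
      2 * Real.log (ridge (vec x) (stageSet O R x z s i t)).det := by
  induction t with
  | zero => simp [stageSet, ridge]
  | succ t ih =>
    have h := ih fun τ hτ => hx τ (by omega)
    have hnot : t ∉ stageSet O R x z s i t := by simp [stageSet]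
    by_cases ht : (decision O R x z t).2 = s ∧ decide ((z t).1 ≤ (decision O R x z t).1) = i
    · have e : stageSet O R x z s i (t + 1) = insert t (stageSet O R x z s i t) := by
        rw [stageSet, Finset.range_add_one, Finset.filter_insert, if_pos ht, stageSet]
      rw [e, Finset.sum_insert hnot]
      linarith [ridgeForm_le_log_det (vec x) _ hnot (hx t (by omega))]
    · have e : stageSet O R x z s i (t + 1) = stageSet O R x z s i t := by
        rw [stageSet, Finset.range_add_one, Finset.filter_insert, if_neg ht, stageSet]
      rw [e]
      exact h

theorem sum_gramNorm_stageSet_le (hd : 1 ≤ d) (z : Trajectory) (s : ℕ) (i : Bool)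
    (hx : ∀ τ < T, vec x τ ⬝ᵥ vec x τ ≤ 1) :
    ∑ τ ∈ stageSet O R x z s i T, gramNorm i (stageRounds O R x z s τ) (x τ) ≤
      √(2 * (T * (d * Real.log (1 + T)))) := by
  have hcard : (stageSet O R x z s i T).card ≤ T := by
    simpa using Finset.card_le_card (stageSet_subset O R x z s i T)
  have hcard' : ((stageSet O R x z s i T).card : ℝ) ≤ T := by exact_mod_cast hcard
  refine Real.le_sqrt_of_sq_le ?_
  refine sq_sum_le_card_mul_sum_sq.trans ?_
  have e : ∑ τ ∈ stageSet O R x z s i T, gramNorm i (stageRounds O R x z s τ) (x τ) ^ 2 =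
      ∑ τ ∈ stageSet O R x z s i T, ridgeForm (vec x) (stageSet O R x z s i τ) (vec x τ) := by
    refine Finset.sum_congr rfl fun τ _ => ?_
    rw [gramNorm_stageRounds, Real.sq_sqrt (ridgeForm_nonneg _ _ _), vec]
  have h1 := sum_ridgeForm_stageSet_le (O := O) (R := R) z s i hx
  have h2 := log_det_ridge_le hd (vec x) (stageSet O R x z s i T)
    (fun τ hτ => hx τ (Finset.mem_range.1 (stageSet_subset O R x z s i T hτ))) hcard
  have h3 : 0 ≤ ∑ τ ∈ stageSet O R x z s i T,
      ridgeForm (vec x) (stageSet O R x z s i τ) (vec x τ) :=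
    Finset.sum_nonneg fun _ _ => ridgeForm_nonneg _ _ _
  rw [e]
  calc _ ≤ (T : ℝ) * (2 * (d * Real.log (1 + T))) :=
        mul_le_mul hcard' (by linarith) h3 (by positivity)
    _ = _ := by ring

/-- The realized weighted norm in round `t`, if it is put into the index set of stage `s`. -/
noncomputable def realizedWidth (O : CDFOracle d) (R : SelectionRule T d) (x : ℕ → Ctx d) (s t : ℕ)
    (z : Trajectory) (m : ℝ) : ℝ :=
  if (decision O R x z t).2 = s then
    (if m ≤ (decision O R x z t).1 then gramNorm true (stageRounds O R x z s t) (x t)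
      else gramNorm false (stageRounds O R x z s t) (x t)) else 0

/-- The mean of the weighted norm in round `t`, if it is put into the index set of stage `s` and the
highest other bid has CDF `g`. -/
noncomputable def meanWidth (O : CDFOracle d) (R : SelectionRule T d) (x : ℕ → Ctx d) (g : ℝ → ℝ)
    (s t : ℕ) (z : Trajectory) : ℝ :=
  if (decision O R x z t).2 = s then
    g (decision O R x z t).1 * gramNorm true (stageRounds O R x z s t) (x t) +
      (1 - g (decision O R x z t).1) * gramNorm false (stageRounds O R x z s t) (x t) else 0

theorem sum_realizedWidth_le (hd : 1 ≤ d) (z : Trajectory) (s : ℕ)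
    (hx : ∀ τ < T, vec x τ ⬝ᵥ vec x τ ≤ 1) :
    ∑ t ∈ Finset.range T, realizedWidth O R x s t z (z t).1 ≤
      2 * √(2 * (T * (d * Real.log (1 + T)))) := by
  have e : ∑ t ∈ Finset.range T, realizedWidth O R x s t z (z t).1 =
      ∑ τ ∈ stageSet O R x z s true T, gramNorm true (stageRounds O R x z s τ) (x τ) +
      ∑ τ ∈ stageSet O R x z s false T, gramNorm false (stageRounds O R x z s τ) (x τ) := by
    rw [stageSet, stageSet, Finset.sum_filter, Finset.sum_filter, ← Finset.sum_add_distrib]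
    refine Finset.sum_congr rfl fun t _ => ?_
    rw [realizedWidth]
    by_cases h1 : (decision O R x z t).2 = s
    · by_cases h2 : (z t).1 ≤ (decision O R x z t).1
      · simp [h1, h2]
      · simp [h1, h2]
    · simp [h1]
  rw [e]
  have h1 := sum_gramNorm_stageSet_le (O := O) (R := R) hd z s true hx
  have h0 := sum_gramNorm_stageSet_le (O := O) (R := R) hd z s false hx
  linarith

theorem gramNorm_stageRounds_le_one (z : Trajectory) (s t : ℕ) (i : Bool)
    (hx : vec x t ⬝ᵥ vec x t ≤ 1) : gramNorm i (stageRounds O R x z s t) (x t) ≤ 1 := by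
  rw [gramNorm_stageRounds]
  exact Real.sqrt_le_one.2 ((ridgeForm_le _ _ _).trans hx)

theorem realizedWidth_mem (s t : ℕ) (z : Trajectory) (m : ℝ) (hx : vec x t ⬝ᵥ vec x t ≤ 1) :
    realizedWidth O R x s t z m ∈ Set.Icc (0 : ℝ) 1 := by
  rw [realizedWidth]
  split_ifs
  · exact ⟨gramNorm_nonneg _ _ _, gramNorm_stageRounds_le_one z s t _ hx⟩
  · exact ⟨gramNorm_nonneg _ _ _, gramNorm_stageRounds_le_one z s t _ hx⟩
  · simp

theorem meanWidth_nonneg (g : ℝ → ℝ) (hg : ∀ b, g b ∈ Set.Icc (0 : ℝ) 1) (s t : ℕ)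
    (z : Trajectory) : 0 ≤ meanWidth O R x g s t z := by
  rw [meanWidth]
  split_ifs
  · exact add_nonneg (mul_nonneg (hg _).1 (gramNorm_nonneg _ _ _))
      (mul_nonneg (sub_nonneg.2 (hg _).2) (gramNorm_nonneg _ _ _))
  · exact le_rfl

end Potential

/-! ### Expectations -/

section Expectation

/-- Fubini for the product law: average over `Z` with `Y` frozen. -/
theorem integral_comp_indep {Ω α β : Type*} [MeasurableSpace Ω] [MeasurableSpace α]
    [MeasurableSpace β] {μ : Measure Ω} [IsProbabilityMeasure μ] {Y : Ω → α} {Z : Ω → β}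
    (h : IndepFun Y Z μ) (hY : Measurable Y) (hZ : Measurable Z) {g : α → β → ℝ}
    (hg : Measurable (Function.uncurry g)) (hint : Integrable (fun ω => g (Y ω) (Z ω)) μ) :
    Integrable (fun ω => ∫ ω', g (Y ω) (Z ω') ∂μ) μ ∧
      ∫ ω, g (Y ω) (Z ω) ∂μ = ∫ ω, ∫ ω', g (Y ω) (Z ω') ∂μ ∂μ := by
  have hmap := (indepFun_iff_map_prod_eq_prod_map_map hY.aemeasurable hZ.aemeasurable).1 h
  have hpY : IsProbabilityMeasure (μ.map Y) := Measure.isProbabilityMeasure_map hY.aemeasurable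
  have hpZ : IsProbabilityMeasure (μ.map Z) := Measure.isProbabilityMeasure_map hZ.aemeasurable
  have hYZ : Measurable fun ω => (Y ω, Z ω) := hY.prodMk hZ
  have hint' : Integrable (Function.uncurry g) ((μ.map Y).prod (μ.map Z)) := by
    rw [← hmap]
    exact (integrable_map_measure hg.aestronglyMeasurable hYZ.aemeasurable).2 hint
  have e1 : ∀ y, ∫ b, g y b ∂(μ.map Z) = ∫ ω', g y (Z ω') ∂μ := fun y =>
    integral_map hZ.aemeasurable
      (hg.comp (measurable_const.prodMk measurable_id)).aestronglyMeasurable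
  have hL := hint'.integral_prod_left
  have h1 : ∫ ω, g (Y ω) (Z ω) ∂μ = ∫ p, Function.uncurry g p ∂(μ.map fun ω => (Y ω, Z ω)) :=
    (integral_map hYZ.aemeasurable hg.aestronglyMeasurable).symm
  constructor
  · have := (integrable_map_measure hL.aestronglyMeasurable hY.aemeasurable).1 hL
    refine this.congr (ae_of_all _ fun ω => ?_)
    exact e1 (Y ω)
  · rw [h1, hmap, integral_prod _ hint', integral_map hY.aemeasurable hL.aestronglyMeasurable]
    refine integral_congr_ae (ae_of_all _ fun ω => ?_)
    exact e1 (Y ω)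

theorem measurable_payoff : Measurable fun p : ℝ × ℝ × ℝ × ℝ => payoff p.1 p.2.1 p.2.2.1 p.2.2.2 := by
  unfold payoff
  refine Measurable.ite (measurableSet_le (by fun_prop) (by fun_prop)) ?_ ?_ <;> fun_prop

theorem abs_payoff_le {b m y₀ y₁ : ℝ} (hb : b ∈ Bids) (h₀ : y₀ ∈ Set.Icc (0 : ℝ) 1)
    (h₁ : y₁ ∈ Set.Icc (0 : ℝ) 1) : |payoff b m y₀ y₁| ≤ 1 := by
  rw [payoff, abs_le]
  split_ifs <;> constructor <;> linarith [hb.1, hb.2, h₀.1, h₀.2, h₁.1, h₁.2]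

variable {Ω : Type*} [MeasurableSpace Ω] {μ : Measure Ω} [IsProbabilityMeasure μ]
  {T d : ℕ} {O : CDFOracle d} {R : SelectionRule T d} {x : ℕ → Ctx d}
  {L : ℝ≥0} {θ₀ θ₁ : Ctx d} {M v₀ v₁ : ℕ → Ω → ℝ}

/-- The expected payoff of the bid `b` in round `t`. -/
noncomputable def expectedReward (μ : Measure Ω) (x : ℕ → Ctx d) (θ₀ θ₁ : Ctx d) (M : ℕ → Ω → ℝ)
    (t : ℕ) (b : ℝ) : ℝ :=
  meanReward (cdf (μ.map (M t))) (θ₁.ofLp ⬝ᵥ vec x t) (θ₀.ofLp ⬝ᵥ vec x t) b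

theorem integral_indicator_le (H : LinearPotentialOutcomes μ T L x θ₀ θ₁ M v₀ v₁) (t : ℕ) (b : ℝ) :
    ∫ ω, (if M t ω ≤ b then (1 : ℝ) else 0) ∂μ = cdf (μ.map (M t)) b := by
  have hp : IsProbabilityMeasure (μ.map (M t)) :=
    Measure.isProbabilityMeasure_map (H.measurable_M t).aemeasurable
  have hms : MeasurableSet {ω | M t ω ≤ b} := H.measurable_M t measurableSet_Iic
  rw [cdf_eq_real, map_measureReal_apply (H.measurable_M t) measurableSet_Iic]
  have e : (fun ω => if M t ω ≤ b then (1 : ℝ) else 0) = {ω | M t ω ≤ b}.indicator 1 := by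
    funext ω
    simp [Set.indicator]
  rw [e, integral_indicator_one hms]
  rfl

theorem integral_payoff (H : LinearPotentialOutcomes μ T L x θ₀ θ₁ M v₀ v₁) {t : ℕ} (ht : t < T)
    (b : ℝ) : ∫ ω, payoff b (M t ω) (v₀ t ω) (v₁ t ω) ∂μ = expectedReward μ x θ₀ θ₁ M t b := by
  let f : ℝ → ℝ := fun m => if m ≤ b then 1 else 0
  have hf : Measurable f := Measurable.ite measurableSet_Iic measurable_const measurable_const
  have hI : ∫ ω, f (M t ω) ∂μ = cdf (μ.map (M t)) b := integral_indicator_le H t b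
  have hv0 : Integrable (v₀ t) μ :=
    Integrable.of_mem_Icc 0 1 (H.measurable_v₀ t).aemeasurable (H.v₀_mem t ht)
  have hv1 : Integrable (v₁ t) μ :=
    Integrable.of_mem_Icc 0 1 (H.measurable_v₁ t).aemeasurable (H.v₁_mem t ht)
  have hfI : Integrable (fun ω => f (M t ω)) μ :=
    Integrable.of_mem_Icc 0 1 (hf.comp (H.measurable_M t)).aemeasurable
      (ae_of_all _ fun ω => by simp only [f]; split_ifs <;> simp)
  have i1 : IndepFun (fun ω => f (M t ω)) (v₁ t) μ :=
    ((H.unconfounded t ht).comp measurable_snd hf).symm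
  have i0 : IndepFun (fun ω => f (M t ω)) (v₀ t) μ :=
    ((H.unconfounded t ht).comp measurable_fst hf).symm
  have e1 : ∫ ω, f (M t ω) * v₁ t ω ∂μ = cdf (μ.map (M t)) b * (θ₁.ofLp ⬝ᵥ vec x t) := by
    rw [← hI, vec, ← inner_eq_dotProduct, ← H.mean_v₁ t ht]
    exact i1.integral_mul_eq_mul_integral hfI.aestronglyMeasurable hv1.aestronglyMeasurable
  have e0 : ∫ ω, f (M t ω) * v₀ t ω ∂μ = cdf (μ.map (M t)) b * (θ₀.ofLp ⬝ᵥ vec x t) := by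
    rw [← hI, vec, ← inner_eq_dotProduct, ← H.mean_v₀ t ht]
    exact i0.integral_mul_eq_mul_integral hfI.aestronglyMeasurable hv0.aestronglyMeasurable
  have m0 : ∫ ω, v₀ t ω ∂μ = θ₀.ofLp ⬝ᵥ vec x t := by
    rw [H.mean_v₀ t ht, inner_eq_dotProduct, vec]
  have j1 : Integrable (fun ω => f (M t ω) * v₁ t ω) μ := i1.integrable_mul hfI hv1
  have j0 : Integrable (fun ω => f (M t ω) * v₀ t ω) μ := i0.integrable_mul hfI hv0
  have e : ∀ ω, payoff b (M t ω) (v₀ t ω) (v₁ t ω) =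
      (f (M t ω) * v₁ t ω - f (M t ω) * b) + (v₀ t ω - f (M t ω) * v₀ t ω) := by
    intro ω
    simp only [payoff, f]
    split_ifs <;> ring
  simp only [e]
  have k1 : Integrable (fun ω => f (M t ω) * v₁ t ω - f (M t ω) * b) μ := j1.sub (hfI.mul_const b)
  have k0 : Integrable (fun ω => v₀ t ω - f (M t ω) * v₀ t ω) μ := hv0.sub j0
  rw [integral_add k1 k0, integral_sub j1 (hfI.mul_const b),
    integral_sub hv0 j0, integral_mul_const, e1, e0, m0, hI, expectedReward, meanReward]
  ring

theorem decision_mem (z : Trajectory) (t : ℕ) : (decision O R x z t).1 ∈ Bids :=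
  stageLoop_mem R t _ _ _ (fun b => O.est_mem _ _ _ b) _ _ subset_rfl ⟨0, by simp⟩

theorem decision_stage_le (z : Trajectory) (t : ℕ) : (decision O R x z t).2 ≤ numStages T := by
  have h := stageLoop_stage R t (fun i => ((z i).1, x i)) (history O R x z t) (x t)
    (estCDF O x z t) (numStages T) 1 Bids
  change (stageLoop R t _ _ _ _ _ _ _).2 ≤ _
  omega

theorem decision_truncate (z : Trajectory) (t : ℕ) :
    decision O R x (truncate t z) t = decision O R x z t :=
  decision_congr O R x fun τ hτ => by rw [truncate, if_pos hτ]

theorem measurable_truncate (t : ℕ) : Measurable (truncate t) := by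
  refine measurable_pi_lambda _ fun τ => ?_
  by_cases h : τ < t
  · simpa [truncate, h] using measurable_pi_apply τ
  · simp [truncate, h]

/-- The decision is a function of the trajectory before round `t`, which is independent of round
`t`; freezing the past reduces the claim to a fixed bid. -/
theorem integral_payoff_decision (H : LinearPotentialOutcomes μ T L x θ₀ θ₁ M v₀ v₁)
    (hdec : ∀ t < T, Measurable fun z : Trajectory => decision O R x z t) {t : ℕ} (ht : t < T) :
    Integrable (fun ω => expectedReward μ x θ₀ θ₁ M t
      (decision O R x (trajectory M v₀ v₁ ω) t).1) μ ∧
    ∫ ω, payoff (decision O R x (trajectory M v₀ v₁ ω) t).1 (M t ω) (v₀ t ω) (v₁ t ω) ∂μ =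
      ∫ ω, expectedReward μ x θ₀ θ₁ M t (decision O R x (trajectory M v₀ v₁ ω) t).1 ∂μ := by
  have hd := hdec t ht
  have htraj := measurable_trajectory H
  have hg : Measurable (Function.uncurry fun (y : Trajectory) (z : ℝ × ℝ × ℝ) =>
      payoff (decision O R x y t).1 z.1 z.2.1 z.2.2) :=
    measurable_payoff.comp ((hd.fst.comp measurable_fst).prodMk measurable_snd)
  have hY := (measurable_truncate t).comp htraj
  have hZ := (measurable_pi_apply t).comp htraj
  have hint : Integrable (fun ω => payoff
      (decision O R x (truncate t (trajectory M v₀ v₁ ω)) t).1 (trajectory M v₀ v₁ ω t).1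
      (trajectory M v₀ v₁ ω t).2.1 (trajectory M v₀ v₁ ω t).2.2) μ := by
    refine Integrable.of_bound (hg.comp (hY.prodMk hZ)).aestronglyMeasurable 1 ?_
    filter_upwards [H.v₀_mem t ht, H.v₁_mem t ht] with ω h0 h1
    exact abs_payoff_le (decision_mem _ _) h0 h1
  have h := integral_comp_indep (indepFun_truncate H ht) hY hZ hg hint
  have e : ∀ ω, ∫ ω', payoff (decision O R x (truncate t (trajectory M v₀ v₁ ω)) t).1
      (trajectory M v₀ v₁ ω' t).1 (trajectory M v₀ v₁ ω' t).2.1 (trajectory M v₀ v₁ ω' t).2.2 ∂μ =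
      expectedReward μ x θ₀ θ₁ M t (decision O R x (trajectory M v₀ v₁ ω) t).1 := by
    intro ω
    rw [decision_truncate]
    exact integral_payoff H ht _
  simp only [e] at h
  refine ⟨h.1, ?_⟩
  rw [← h.2]
  simp only [decision_truncate]
  rfl

theorem measurable_gramNorm_stageRounds
    (hdec : ∀ t < T, Measurable fun z : Trajectory => decision O R x z t) (s : ℕ) (i : Bool) {t : ℕ}
    (ht : t ≤ T) (y : Ctx d) : Measurable fun z => gramNorm i (stageRounds O R x z s t) y := by
  simp only [gramNorm_stageRounds]
  exact measurable_comp_stageSet hdec s i ht fun W => √(ridgeForm (vec x) W y.ofLp)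

theorem measurable_realizedWidth
    (hdec : ∀ t < T, Measurable fun z : Trajectory => decision O R x z t) (s : ℕ) {t : ℕ}
    (ht : t < T) : Measurable (Function.uncurry (realizedWidth O R x s t)) := by
  have hfst : Measurable (Prod.fst : Trajectory × ℝ → Trajectory) := measurable_fst
  have hd := (hdec t ht).comp hfst
  have h1 := (measurable_gramNorm_stageRounds hdec s true ht.le (x t)).comp hfst
  have h0 := (measurable_gramNorm_stageRounds hdec s false ht.le (x t)).comp hfst
  refine Measurable.ite (hd.snd (measurableSet_singleton s))
    (Measurable.ite (measurableSet_le measurable_snd hd.fst) h1 h0) measurable_const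

theorem realizedWidth_truncate (s t : ℕ) (z : Trajectory) (m : ℝ) :
    realizedWidth O R x s t (truncate t z) m = realizedWidth O R x s t z m := by
  have h : ∀ i, stageSet O R x (truncate t z) s i t = stageSet O R x z s i t := fun i =>
    stageSet_congr O R x (fun τ hτ => by rw [truncate, if_pos hτ]) s i
  simp only [realizedWidth, decision_truncate, gramNorm_stageRounds, h]

theorem integral_realizedWidth (H : LinearPotentialOutcomes μ T L x θ₀ θ₁ M v₀ v₁) (s t : ℕ)
    (z : Trajectory) : ∫ ω, realizedWidth O R x s t z (M t ω) ∂μ =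
      meanWidth O R x (cdf (μ.map (M t))) s t z := by
  by_cases hs : (decision O R x z t).2 = s
  · have hI := integral_indicator_le H t (decision O R x z t).1
    have hint : Integrable
        (fun ω => if M t ω ≤ (decision O R x z t).1 then (1 : ℝ) else 0) μ :=
      Integrable.of_mem_Icc 0 1 (Measurable.ite (measurableSet_le (H.measurable_M t)
        measurable_const) measurable_const measurable_const).aemeasurable
        (ae_of_all _ fun ω => by split_ifs <;> simp)
    have e : ∀ ω, realizedWidth O R x s t z (M t ω) =
        (if M t ω ≤ (decision O R x z t).1 then (1 : ℝ) else 0) *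
          (gramNorm true (stageRounds O R x z s t) (x t) -
            gramNorm false (stageRounds O R x z s t) (x t)) +
          gramNorm false (stageRounds O R x z s t) (x t) := by
      intro ω
      rw [realizedWidth, if_pos hs]
      split_ifs <;> ring
    simp only [e]
    rw [integral_add (hint.mul_const _) (integrable_const _), integral_mul_const, hI,
      integral_const, meanWidth, if_pos hs]
    simp
    ring
  · simp [realizedWidth, meanWidth, hs]

/-- The norms and the bid are determined by the past, and only the group joined in round `t` depends
on `M t`. This links the width, which mixes both groups, to the potential argument, which sees one.
-/
theorem integral_meanWidth (H : LinearPotentialOutcomes μ T L x θ₀ θ₁ M v₀ v₁)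
    (hdec : ∀ t < T, Measurable fun z : Trajectory => decision O R x z t) (s : ℕ) {t : ℕ}
    (ht : t < T) :
    Integrable (fun ω => meanWidth O R x (cdf (μ.map (M t))) s t (trajectory M v₀ v₁ ω)) μ ∧
    Integrable (fun ω => realizedWidth O R x s t (trajectory M v₀ v₁ ω) (M t ω)) μ ∧
    ∫ ω, meanWidth O R x (cdf (μ.map (M t))) s t (trajectory M v₀ v₁ ω) ∂μ =
      ∫ ω, realizedWidth O R x s t (trajectory M v₀ v₁ ω) (M t ω) ∂μ := by
  have htraj := measurable_trajectory H
  have hg := measurable_realizedWidth hdec s ht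
  have hY := (measurable_truncate t).comp htraj
  have hZ := H.measurable_M t
  have hind : IndepFun (fun ω => truncate t (trajectory M v₀ v₁ ω)) (M t) μ :=
    (indepFun_truncate H ht).comp measurable_id measurable_fst
  have hint : Integrable (fun ω =>
      realizedWidth O R x s t (truncate t (trajectory M v₀ v₁ ω)) (M t ω)) μ :=
    Integrable.of_mem_Icc 0 1 (hg.comp (hY.prodMk hZ)).aemeasurable
      (ae_of_all _ fun ω => realizedWidth_mem s t _ _ (vec_dotProduct_self H ht))
  have h := integral_comp_indep hind hY hZ hg hint
  simp only [realizedWidth_truncate, integral_realizedWidth H] at h hint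
  exact ⟨h.1, hint, h.2.symm⟩

end Expectation

/-! ### The regret bound -/

/-! ### Number of stages and absolute constants. -/

section Numerics

theorem half_pow_numStages_le {T : ℕ} (hT : 2 ≤ T) :
    (1 / 2 : ℝ) ^ numStages T ≤ 1 / √(T : ℝ) := by
  have hT0 : (0 : ℝ) < T := by exact_mod_cast (by omega : 0 < T)
  have hs : 0 < √(T : ℝ) := Real.sqrt_pos.2 hT0
  have h : Real.logb 2 √(T : ℝ) ≤ (numStages T : ℝ) := Nat.le_ceil _
  rw [Real.logb_le_iff_le_rpow one_lt_two hs, Real.rpow_natCast] at h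
  rw [div_pow, one_pow]
  exact one_div_le_one_div_of_le hs h

theorem one_le_numStages {T : ℕ} (hT : 2 ≤ T) : 1 ≤ numStages T := by
  have hT0 : (1 : ℝ) < T := by exact_mod_cast (by omega : 1 < T)
  refine Nat.one_le_iff_ne_zero.2 (Nat.ceil_pos.2 ?_).ne'
  exact Real.logb_pos one_lt_two (by rwa [Real.lt_sqrt zero_le_one, one_pow])

theorem numStages_le {T : ℕ} (hT : 2 ≤ T) : (numStages T : ℝ) ≤ 3 * Real.log T := by
  have hT2 : (2 : ℝ) ≤ T := by exact_mod_cast hT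
  have hl2 := Real.log_two_gt_d9
  have hl : Real.log 2 ≤ Real.log T := Real.log_le_log two_pos hT2
  have h0 : 0 ≤ Real.logb 2 √(T : ℝ) :=
    Real.logb_nonneg one_lt_two (Real.one_le_sqrt.2 (by linarith))
  have h1 : (numStages T : ℝ) < Real.logb 2 √(T : ℝ) + 1 := Nat.ceil_lt_add_one h0
  have h2 : Real.logb 2 √(T : ℝ) ≤ 4 / 5 * Real.log T := by
    rw [Real.logb, Real.log_sqrt (by linarith), div_le_iff₀ (by linarith)]
    nlinarith
  linarith

theorem regret_terms_le {T d : ℕ} (hT : 2 ≤ T) (hd : 1 ≤ d) {D : ℝ} (hD : 0 ≤ D) :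
    3 * √(T : ℝ) + (6 * ((numStages T : ℝ) + 1) + 8 * (√(Real.log (2 * T)) + 1)) * D +
      8 * (√(Real.log (2 * T)) + 1) *
        (numStages T * (2 * √(2 * (T * (d * Real.log (1 + T)))))) +
      3 * ((numStages T : ℝ) + 1) ≤
    400 * (√((d : ℝ) * T) * Real.log T ^ 2 + D * Real.log T ^ (3 / 2 : ℝ)) := by
  have hT2 : (2 : ℝ) ≤ T := by exact_mod_cast hT
  have hd1 : (1 : ℝ) ≤ d := by exact_mod_cast hd
  have hl2 := Real.log_two_gt_d9
  have hl : Real.log 2 ≤ Real.log T := Real.log_le_log two_pos hT2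
  have hS := numStages_le hT
  have hS0 : (0 : ℝ) ≤ numStages T := Nat.cast_nonneg _
  have hlog2T : Real.log (2 * T) ≤ 2 * Real.log T := by
    rw [Real.log_mul (by norm_num) (by linarith)]
    linarith
  have hlog1T : Real.log (1 + T) ≤ 2 * Real.log T := by
    refine le_trans (Real.log_le_log (by linarith) ?_) hlog2T
    linarith
  have hpow : Real.log T ^ (3 / 2 : ℝ) = Real.log T * √(Real.log T) := by
    rw [show (3 / 2 : ℝ) = 1 + 1 / 2 by norm_num, Real.rpow_add (by linarith), Real.rpow_one,
      Real.sqrt_eq_rpow]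
  have hq2 : √(Real.log T) ^ 2 = Real.log T := Real.sq_sqrt (by linarith)
  have hq : 4 / 5 ≤ √(Real.log T) := by
    refine Real.le_sqrt_of_sq_le ?_
    norm_num
    linarith
  have hβ : √(Real.log (2 * T)) ≤ 3 / 2 * √(Real.log T) := by
    refine (Real.sqrt_le_left (by positivity)).2 ?_
    rw [mul_pow, hq2]
    linarith
  have hP1 : √(T : ℝ) ≤ √((d : ℝ) * T) := Real.sqrt_le_sqrt (by nlinarith)
  have hP0 : 1 ≤ √(T : ℝ) := Real.one_le_sqrt.2 (by linarith)
  have hE : √(2 * (T * (d * Real.log (1 + T)))) ≤ 2 * √((d : ℝ) * T) * √(Real.log T) := by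
    refine (Real.sqrt_le_left (by positivity)).2 ?_
    rw [mul_pow, mul_pow, hq2, Real.sq_sqrt (by positivity)]
    have : (T : ℝ) * d * Real.log (1 + T) ≤ T * d * (2 * Real.log T) := by gcongr
    linarith
  rw [hpow]
  set q := √(Real.log T) with hqdef
  set P := √((d : ℝ) * T) with hPdef
  set β := √(Real.log (2 * T)) with hβdef
  set S : ℝ := (numStages T : ℝ) with hSdef
  rw [← hq2] at hS hl ⊢
  have hq0 : 0 ≤ q := by linarith
  have hβ1 : β + 1 ≤ 3 * q := by linarith
  have hβ0 : 0 ≤ β := Real.sqrt_nonneg _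
  have hS1 : S + 1 ≤ 5 * q ^ 2 := by linarith
  have hPone : 1 ≤ P := hP0.trans hP1
  -- From `q ≥ 4/5`: `1/q ≤ 5/4`, `1/q² ≤ 8/5` and `1/q⁴ ≤ 5/2`.
  have hqq : q ≤ 8 / 5 * (q ^ 2 * q) := by nlinarith
  have hq23 : q ^ 2 ≤ 5 / 4 * (q ^ 2 * q) := by nlinarith
  have hq24 : 1 ≤ 5 / 2 * (q ^ 2) ^ 2 := by nlinarith
  have hq25 : q ^ 2 ≤ 8 / 5 * (q ^ 2) ^ 2 := by nlinarith
  have t1 : 3 * √(T : ℝ) ≤ 8 * (P * (q ^ 2) ^ 2) := by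
    have : P * 1 ≤ P * (5 / 2 * (q ^ 2) ^ 2) := by gcongr
    nlinarith
  have t2 : (6 * (S + 1) + 8 * (β + 1)) * D ≤ 80 * (D * (q ^ 2 * q)) := by
    have : 6 * (S + 1) + 8 * (β + 1) ≤ 80 * (q ^ 2 * q) := by linarith
    calc _ ≤ 80 * (q ^ 2 * q) * D := by gcongr
      _ = _ := by ring
  have t3 : 8 * (β + 1) * (S * (2 * √(2 * (T * (d * Real.log (1 + T)))))) ≤
      288 * (P * (q ^ 2) ^ 2) := by
    calc _ ≤ 8 * (3 * q) * (3 * q ^ 2 * (2 * (2 * P * q))) := by gcongr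
      _ = _ := by ring
  have t4 : 3 * (S + 1) ≤ 24 * (P * (q ^ 2) ^ 2) := by
    have : 1 * (q ^ 2) ^ 2 ≤ P * (q ^ 2) ^ 2 := by gcongr
    linarith
  have n1 : 0 ≤ P * (q ^ 2) ^ 2 := by positivity
  have n2 : 0 ≤ D * (q ^ 2 * q) := by positivity
  linarith

end Numerics

/-! ### Regret of one round, and summation. -/

section Regret

variable {Ω : Type*} [MeasurableSpace Ω] {μ : Measure Ω}
  {T d : ℕ} {O : CDFOracle d} {R : SelectionRule T d} {x : ℕ → Ctx d}
  {L : ℝ≥0} {θ₀ θ₁ : Ctx d} {M v₀ v₁ : ℕ → Ω → ℝ} {ε : ℕ → ℝ}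

theorem abs_param_dotProduct_le (H : LinearPotentialOutcomes μ T L x θ₀ θ₁ M v₀ v₁) (i : Bool)
    {t : ℕ} (ht : t < T) : |(param θ₀ θ₁ i).ofLp ⬝ᵥ vec x t| ≤ 1 := by
  refine abs_le_one_iff_mul_self_le_one.2 ?_
  rw [← sq]
  refine (sq_dotProduct_le _ _).trans ?_
  exact mul_le_one₀ (param_dotProduct_self H i) (dotProduct_self_nonneg_real _)
    (vec_dotProduct_self H ht)

theorem meanReward_sub_le {g : ℝ → ℝ} (hg : ∀ b, g b ∈ Set.Icc (0 : ℝ) 1) {p q : ℝ}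
    (hp : |p| ≤ 1) (hq : |q| ≤ 1) {b b' : ℝ} (hb : b ∈ Bids) (hb' : b' ∈ Bids) :
    meanReward g p q b - meanReward g p q b' ≤ 3 := by
  rw [abs_le] at hp hq
  have h := hg b
  have h' := hg b'
  rw [meanReward, meanReward]
  have k1 : g b * (p - b) + (1 - g b) * q ≤ 1 := by
    nlinarith [mul_nonneg h.1 (by linarith [hb.1] : 0 ≤ 1 - (p - b)),
      mul_nonneg (sub_nonneg.2 h.2) (by linarith : 0 ≤ 1 - q)]
  have k2 : -2 ≤ g b' * (p - b') + (1 - g b') * q := by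
    nlinarith [mul_nonneg h'.1 (by linarith [hb'.2] : 0 ≤ 2 + (p - b')),
      mul_nonneg (sub_nonneg.2 h'.2) (by linarith : 0 ≤ 2 + q)]
  linarith

theorem cdf_mem (ν : Measure ℝ) (b : ℝ) : cdf ν b ∈ Set.Icc (0 : ℝ) 1 :=
  ⟨cdf_nonneg ν b, cdf_le_one ν b⟩

theorem expectedReward_sub_le (H : LinearPotentialOutcomes μ T L x θ₀ θ₁ M v₀ v₁) {t : ℕ}
    (ht : t < T) {b b' : ℝ} (hb : b ∈ Bids) (hb' : b' ∈ Bids) :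
    expectedReward μ x θ₀ θ₁ M t b - expectedReward μ x θ₀ θ₁ M t b' ≤ 3 :=
  meanReward_sub_le (cdf_mem _) (abs_param_dotProduct_le H true ht)
    (abs_param_dotProduct_le H false ht) hb hb'

/-- The width at the estimated CDF exceeds the one at the true CDF by at most the estimation
error. -/
theorem width_le_meanWidth (z : Trajectory) {s t : ℕ} {g : ℝ → ℝ} {e : ℝ}
    (hs : (decision O R x z t).2 = s) (hx : vec x t ⬝ᵥ vec x t ≤ 1)
    (he : |estCDF O x z t (decision O R x z t).1 - g (decision O R x z t).1| ≤ e) :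
    width T (stageRounds O R x z s t) (x t) (estCDF O x z t) (decision O R x z t).1 ≤
      (√(Real.log (2 * T)) + 1) * (meanWidth O R x g s t z + e) := by
  have h1 := gramNorm_stageRounds_le_one (O := O) (R := R) z s t true hx
  have h0 := gramNorm_stageRounds_le_one (O := O) (R := R) z s t false hx
  have k1 := gramNorm_nonneg true (stageRounds O R x z s t) (x t)
  have k0 := gramNorm_nonneg false (stageRounds O R x z s t) (x t)
  rw [width, meanWidth, if_pos hs]
  set N1 := gramNorm true (stageRounds O R x z s t) (x t)
  set N0 := gramNorm false (stageRounds O R x z s t) (x t)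
  have hN : |N1 - N0| ≤ 1 := abs_le.2 ⟨by linarith, by linarith⟩
  have hdiff : (estCDF O x z t (decision O R x z t).1 - g (decision O R x z t).1) * (N1 - N0) ≤
      e := by
    refine (le_abs_self _).trans ?_
    rw [abs_mul]
    exact (mul_le_of_le_one_right (abs_nonneg _) hN).trans he
  rw [mul_assoc, mul_assoc, ← mul_add]
  exact mul_le_mul_of_nonneg_left (by linarith) (by positivity)

theorem expectedReward_decision_regret (H : LinearPotentialOutcomes μ T L x θ₀ θ₁ M v₀ v₁)
    (hT : 2 ≤ T) {t : ℕ} (ht : t < T) (z : Trajectory) {e : ℝ}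
    (hacc : ∀ b ∈ Bids, |estCDF O x z t b - cdf (μ.map (M t)) b| ≤ e)
    (hstage : ∀ s, 1 ≤ s → s ≤ numStages T → ∀ i, StageAccurate O R x θ₀ θ₁ s t i z)
    {b₀ : ℝ} (hb₀ : b₀ ∈ Bids) :
    expectedReward μ x θ₀ θ₁ M t b₀ - expectedReward μ x θ₀ θ₁ M t (decision O R x z t).1 ≤
      3 * (1 / √(T : ℝ)) +
        (6 * ((numStages T : ℝ) + 1) + 8 * (√(Real.log (2 * T)) + 1)) * e +
        8 * (√(Real.log (2 * T)) + 1) *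
          ∑ s ∈ Finset.Icc 1 (numStages T), meanWidth O R x (cdf (μ.map (M t))) s t z := by
  have he : 0 ≤ e := (abs_nonneg _).trans (hacc 0 (by simp))
  obtain ⟨n, hn⟩ : ∃ n, numStages T = n + 1 :=
    Nat.exists_eq_succ_of_ne_zero (Nat.one_le_iff_ne_zero.1 (one_le_numStages hT))
  have hx := vec_dotProduct_self H ht
  have hG : ∀ b, estCDF O x z t b ∈ Set.Icc (0 : ℝ) 1 := fun b => O.est_mem _ _ _ b
  have hw : ∀ s ∈ Finset.Icc 1 (numStages T),
      0 ≤ meanWidth O R x (cdf (μ.map (M t))) s t z := fun s _ =>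
    meanWidth_nonneg _ (cdf_mem _) s t z
  have hconf : ∀ j, 1 ≤ j → j ≤ numStages T → ∀ b ∈ Bids,
      |rewardEst (stageRounds O R x z j t) (x t) (estCDF O x z t) b -
        expectedReward μ x θ₀ θ₁ M t b| ≤
        width T (stageRounds O R x z j t) (x t) (estCDF O x z t) b + 3 * e := fun j h1 h2 b hb =>
    abs_rewardEst_sub_le (hG b) hb (abs_param_dotProduct_le H true ht)
      (abs_param_dotProduct_le H false ht) (hacc b hb) (hstage j h1 h2 true)
      (hstage j h1 h2 false)
  have hdec : decision O R x z t = stageLoop R t (fun i => ((z i).1, x i)) (history O R x z t)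
      (x t) (estCDF O x z t) (n + 1) 1 Bids := by
    rw [← hn]; rfl
  have key := stageLoop_regret R t (fun i => ((z i).1, x i)) (history O R x z t) (x t) hG he
    (half_pow_numStages_le hT) hconf n 1 le_rfl (by omega) subset_rfl ⟨0, by simp⟩
    (fun b hb => ⟨b, hb, by push_cast; linarith⟩)
    -- At stage `1` the gap bound holds for all bids, since expected rewards differ by at most `3 ≤
    -- 8 · 2^{-1}`.
    (fun b hb b' hb' => by
      have := expectedReward_sub_le H ht hb' hb
      push_cast
      linarith) _ hdec hb₀
  have hβ : 0 ≤ √(Real.log (2 * T)) := Real.sqrt_nonneg _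
  have hsqrt : 0 ≤ 1 / √(T : ℝ) := by positivity
  rcases key with ⟨-, hle⟩ | ⟨h1, hwid, hle⟩
  · have h2 := mul_nonneg (by positivity : 0 ≤ 8 * (√(Real.log (2 * T)) + 1))
      (Finset.sum_nonneg hw)
    have h3 : 0 ≤ 8 * (√(Real.log (2 * T)) + 1) * e := by positivity
    linarith
  · have h2 := decision_stage_le (O := O) (R := R) (x := x) z t
    have h3 := Finset.single_le_sum hw (Finset.mem_Icc.2 ⟨h1, h2⟩)
    have h4 := hwid.le.trans
      (width_le_meanWidth z rfl hx (hacc _ (decision_mem (O := O) (R := R) (x := x) z t)))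
    have h5 := mul_le_mul_of_nonneg_left h3 (by positivity : 0 ≤ √(Real.log (2 * T)) + 1)
    linarith

variable [IsProbabilityMeasure μ]

/-- A negative `ε t` would make the failure event certain, against its probability bound `1 / T <
1`. -/
theorem error_nonneg (hT : 2 ≤ T) (hacc : OracleAccurate μ T O x M v₀ v₁ ε) {t : ℕ} (ht : t < T) :
    0 ≤ ε t := by
  have hT' : (2 : ℝ) ≤ T := by exact_mod_cast hT
  by_contra hneg
  have huniv : {ω | ¬ ∀ t < T, ∀ b ∈ Bids,
      |estCDF O x (trajectory M v₀ v₁ ω) t b - cdf (μ.map (M t)) b| ≤ ε t} = Set.univ := by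
    refine Set.eq_univ_of_forall fun ω h => hneg ?_
    exact (abs_nonneg _).trans (h t ht 0 (by simp))
  rw [OracleAccurate, huniv, measure_univ, ENNReal.one_le_ofReal, one_le_div (by linarith)] at hacc
  linarith

/-- The event that the oracle or the estimates of some stage are inaccurate. -/
def inaccurate (μ : Measure Ω) (O : CDFOracle d) (R : SelectionRule T d) (x : ℕ → Ctx d)
    (θ₀ θ₁ : Ctx d) (M v₀ v₁ : ℕ → Ω → ℝ) (ε : ℕ → ℝ) : Set Ω :=
  {ω | ¬ ∀ t < T, ∀ b ∈ Bids,
    |estCDF O x (trajectory M v₀ v₁ ω) t b - cdf (μ.map (M t)) b| ≤ ε t} ∪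
  ⋃ t ∈ Finset.range T, ⋃ s ∈ Finset.Icc 1 (numStages T), ⋃ i ∈ (Finset.univ : Finset Bool),
    {ω | ¬ StageAccurate O R x θ₀ θ₁ s t i (trajectory M v₀ v₁ ω)}

/-- The oracle contributes `1 / T`; the `T` rounds, `S` stages and two groups contribute `1 / (2
T²)` each. -/
theorem measureReal_inaccurate_le (H : LinearPotentialOutcomes μ T L x θ₀ θ₁ M v₀ v₁)
    (hdec : ∀ t < T, Measurable fun z : Trajectory => decision O R x z t) (hT : 2 ≤ T)
    (hacc : OracleAccurate μ T O x M v₀ v₁ ε) :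
    μ.real (inaccurate μ O R x θ₀ θ₁ M v₀ v₁ ε) ≤ ((numStages T : ℝ) + 1) / T := by
  have hT' : (2 : ℝ) ≤ T := by exact_mod_cast hT
  refine (measureReal_union_le _ _).trans ?_
  have h1 : μ.real {ω | ¬ ∀ t < T, ∀ b ∈ Bids,
      |estCDF O x (trajectory M v₀ v₁ ω) t b - cdf (μ.map (M t)) b| ≤ ε t} ≤ 1 / T := by
    have := ENNReal.toReal_mono ENNReal.ofReal_ne_top hacc
    rwa [ENNReal.toReal_ofReal (by positivity)] at this
  have h2 : μ.real (⋃ t ∈ Finset.range T, ⋃ s ∈ Finset.Icc 1 (numStages T),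
      ⋃ i ∈ (Finset.univ : Finset Bool),
        {ω | ¬ StageAccurate O R x θ₀ θ₁ s t i (trajectory M v₀ v₁ ω)}) ≤
      ∑ t ∈ Finset.range T, ∑ s ∈ Finset.Icc 1 (numStages T),
        ∑ i ∈ (Finset.univ : Finset Bool), 1 / (2 * (T : ℝ) ^ 2) := by
    refine (measureReal_biUnion_finset_le _ _).trans (Finset.sum_le_sum fun t ht => ?_)
    refine (measureReal_biUnion_finset_le _ _).trans (Finset.sum_le_sum fun s hs => ?_)
    refine (measureReal_biUnion_finset_le _ _).trans (Finset.sum_le_sum fun i _ => ?_)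
    exact measureReal_not_stageAccurate_le H hdec hT i (Finset.mem_Icc.1 hs).1
      (Finset.mem_range.1 ht)
  have h3 : ∑ t ∈ Finset.range T, ∑ s ∈ Finset.Icc 1 (numStages T),
      ∑ i ∈ (Finset.univ : Finset Bool), 1 / (2 * (T : ℝ) ^ 2) = (numStages T : ℝ) / T := by
    simp only [Finset.sum_const, Finset.card_range, Nat.card_Icc, Finset.card_univ,
      Fintype.card_bool, nsmul_eq_mul, Nat.add_sub_cancel]
    push_cast
    field_simp
  rw [h3] at h2
  rw [add_div]
  linarith

theorem round_regret_le (H : LinearPotentialOutcomes μ T L x θ₀ θ₁ M v₀ v₁)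
    (hdec : ∀ t < T, Measurable fun z : Trajectory => decision O R x z t) (hT : 2 ≤ T)
    (hacc : OracleAccurate μ T O x M v₀ v₁ ε) {t : ℕ} (ht : t < T) {b₀ : ℝ} (hb₀ : b₀ ∈ Bids) :
    ∫ ω, payoff b₀ (M t ω) (v₀ t ω) (v₁ t ω) ∂μ -
      ∫ ω, payoff (decision O R x (trajectory M v₀ v₁ ω) t).1 (M t ω) (v₀ t ω) (v₁ t ω) ∂μ ≤
      3 * (1 / √(T : ℝ)) +
        (6 * ((numStages T : ℝ) + 1) + 8 * (√(Real.log (2 * T)) + 1)) * ε t +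
        8 * (√(Real.log (2 * T)) + 1) * ∑ s ∈ Finset.Icc 1 (numStages T),
          ∫ ω, realizedWidth O R x s t (trajectory M v₀ v₁ ω) (M t ω) ∂μ +
        3 * (((numStages T : ℝ) + 1) / T) := by
  have hε := error_nonneg hT hacc ht
  obtain ⟨hint, hpay⟩ := integral_payoff_decision H hdec ht
  have hmw := fun s => integral_meanWidth H hdec s ht
  -- Accuracy over all bids is an uncountable intersection, not known to be measurable; the
  -- measurable hull has the same measure.
  let B : Set Ω := toMeasurable μ (inaccurate μ O R x θ₀ θ₁ M v₀ v₁ ε)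
  have hB : MeasurableSet B := measurableSet_toMeasurable _ _
  have hBle : μ.real B ≤ ((numStages T : ℝ) + 1) / T := by
    rw [Measure.real, measure_toMeasurable]
    exact measureReal_inaccurate_le H hdec hT hacc
  let c : ℝ := 3 * (1 / √(T : ℝ)) +
    (6 * ((numStages T : ℝ) + 1) + 8 * (√(Real.log (2 * T)) + 1)) * ε t
  let k : ℝ := 8 * (√(Real.log (2 * T)) + 1)
  have hc : 0 ≤ c := by positivity
  have hk : 0 ≤ k := by positivity
  let m : Ω → ℝ := fun ω => ∑ s ∈ Finset.Icc 1 (numStages T),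
    meanWidth O R x (cdf (μ.map (M t))) s t (trajectory M v₀ v₁ ω)
  have hm : Integrable m μ := integrable_finsetSum _ fun s _ => (hmw s).1
  have hm0 : ∀ ω, 0 ≤ m ω := fun ω =>
    Finset.sum_nonneg fun s _ => meanWidth_nonneg _ (cdf_mem _) s t _
  have hpt : ∀ ω, expectedReward μ x θ₀ θ₁ M t b₀ -
      expectedReward μ x θ₀ θ₁ M t (decision O R x (trajectory M v₀ v₁ ω) t).1 ≤
      c + k * m ω + B.indicator (fun _ => 3) ω := by
    intro ω
    by_cases hω : ω ∈ B
    · rw [Set.indicator_of_mem hω]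
      have h1 := expectedReward_sub_le H ht hb₀
        (decision_mem (O := O) (R := R) (x := x) (trajectory M v₀ v₁ ω) t)
      have h2 := mul_nonneg hk (hm0 ω)
      linarith
    · rw [Set.indicator_of_notMem hω, add_zero]
      have hω' : ω ∉ inaccurate μ O R x θ₀ θ₁ M v₀ v₁ ε := fun h => hω (subset_toMeasurable _ _ h)
      simp only [inaccurate, Set.mem_union, Set.mem_iUnion, Set.mem_ofPred_eq, not_or, not_not,
        not_exists] at hω'
      exact expectedReward_decision_regret H hT ht _ (hω'.1 t ht) (fun s h1 h2 i =>
        hω'.2 t (Finset.mem_range.2 ht) s (Finset.mem_Icc.2 ⟨h1, h2⟩) i (Finset.mem_univ i)) hb₀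
  have hind : Integrable (B.indicator fun _ => (3 : ℝ)) μ := (integrable_const 3).indicator hB
  have hck : Integrable (fun ω => c + k * m ω) μ := (integrable_const c).add (hm.const_mul k)
  have hI : ∫ ω, (c + k * m ω + B.indicator (fun _ => 3) ω) ∂μ =
      c + k * (∑ s ∈ Finset.Icc 1 (numStages T),
        ∫ ω, realizedWidth O R x s t (trajectory M v₀ v₁ ω) (M t ω) ∂μ) + 3 * μ.real B := by
    rw [integral_add hck hind, integral_add (integrable_const c) (hm.const_mul k),
      integral_const_mul, integral_finsetSum _ fun s _ => (hmw s).1, integral_indicator hB]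
    simp only [(hmw _).2.2, integral_const, smul_eq_mul, probReal_univ, one_mul,
      measureReal_restrict_apply_univ]
    ring
  rw [hpay, integral_payoff H ht]
  calc expectedReward μ x θ₀ θ₁ M t b₀ - ∫ ω, expectedReward μ x θ₀ θ₁ M t
        (decision O R x (trajectory M v₀ v₁ ω) t).1 ∂μ
      = ∫ ω, (expectedReward μ x θ₀ θ₁ M t b₀ - expectedReward μ x θ₀ θ₁ M t
        (decision O R x (trajectory M v₀ v₁ ω) t).1) ∂μ := by
        rw [integral_sub (integrable_const _) hint]
        simp
    _ ≤ ∫ ω, (c + k * m ω + B.indicator (fun _ => 3) ω) ∂μ :=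
        integral_mono ((integrable_const _).sub hint) (hck.add hind) hpt
    _ ≤ _ := by
        rw [hI]
        linarith

theorem sum_integral_realizedWidth_le (H : LinearPotentialOutcomes μ T L x θ₀ θ₁ M v₀ v₁)
    (hdec : ∀ t < T, Measurable fun z : Trajectory => decision O R x z t) (hd : 1 ≤ d) (s : ℕ) :
    ∑ t ∈ Finset.range T, ∫ ω, realizedWidth O R x s t (trajectory M v₀ v₁ ω) (M t ω) ∂μ ≤
      2 * √(2 * (T * (d * Real.log (1 + T)))) := by
  have hint : ∀ t ∈ Finset.range T,
      Integrable (fun ω => realizedWidth O R x s t (trajectory M v₀ v₁ ω) (M t ω)) μ :=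
    fun t ht => (integral_meanWidth H hdec s (Finset.mem_range.1 ht)).2.1
  rw [← integral_finsetSum _ hint]
  refine (integral_mono (integrable_finsetSum _ hint) (integrable_const _) fun ω =>
    sum_realizedWidth_le hd (trajectory M v₀ v₁ ω) s fun τ hτ =>
      vec_dotProduct_self H hτ).trans ?_
  simp

theorem regret_le (H : LinearPotentialOutcomes μ T L x θ₀ θ₁ M v₀ v₁)
    (hdec : ∀ t < T, Measurable fun z : Trajectory => decision O R x z t) (hT : 2 ≤ T)
    (hd : 1 ≤ d) (hacc : OracleAccurate μ T O x M v₀ v₁ ε) {bstar : ℕ → ℝ}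
    (hb : ∀ t < T, bstar t ∈ Bids) :
    regret μ O R x M v₀ v₁ bstar ≤
      3 * √(T : ℝ) + (6 * ((numStages T : ℝ) + 1) + 8 * (√(Real.log (2 * T)) + 1)) *
        (∑ t ∈ Finset.range T, ε t) +
      8 * (√(Real.log (2 * T)) + 1) *
        (numStages T * (2 * √(2 * (T * (d * Real.log (1 + T)))))) +
      3 * ((numStages T : ℝ) + 1) := by
  have hT' : (0 : ℝ) < T := by exact_mod_cast (by omega : 0 < T)
  refine (Finset.sum_le_sum fun t ht => round_regret_le H hdec hT hacc (Finset.mem_range.1 ht)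
    (hb t (Finset.mem_range.1 ht))).trans ?_
  -- Exchanging rounds and stages lets the potential bound apply at each fixed stage.
  rw [Finset.sum_add_distrib, Finset.sum_add_distrib, Finset.sum_add_distrib, ← Finset.mul_sum,
    ← Finset.mul_sum, ← Finset.mul_sum, Finset.sum_comm, Finset.sum_const, Finset.sum_const, Finset.card_range,
    nsmul_eq_mul, nsmul_eq_mul]
  have e1 : (T : ℝ) * (1 / √(T : ℝ)) = √(T : ℝ) := by
    rw [mul_one_div, Real.div_sqrt]
  have e2 : (T : ℝ) * (3 * (((numStages T : ℝ) + 1) / T)) = 3 * ((numStages T : ℝ) + 1) := by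
    field_simp
  have h3 : ∑ s ∈ Finset.Icc 1 (numStages T), ∑ t ∈ Finset.range T,
      ∫ ω, realizedWidth O R x s t (trajectory M v₀ v₁ ω) (M t ω) ∂μ ≤
      numStages T * (2 * √(2 * (T * (d * Real.log (1 + T))))) := by
    refine (Finset.sum_le_sum fun s _ => sum_integral_realizedWidth_le H hdec hd s).trans ?_
    simp
  rw [e1, e2]
  gcongr

end Regret

end Auction

theorem mainTheorem3 : ∃ C : ℝ, 0 < C ∧
    ∀ (T d : ℕ), 2 ≤ T → 1 ≤ d →
    ∀ (O : Auction.CDFOracle d) (R : Auction.SelectionRule T d)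
      (Ω : Type*) [MeasurableSpace Ω] (μ : Measure Ω) [IsProbabilityMeasure μ]
      (L : ℝ≥0) (x : ℕ → Auction.Ctx d) (θ₀ θ₁ : Auction.Ctx d) (M v₀ v₁ : ℕ → Ω → ℝ)
      (ε : ℕ → ℝ) (bstar : ℕ → ℝ),
      Auction.LinearPotentialOutcomes μ T L x θ₀ θ₁ M v₀ v₁ →
      Auction.OracleAccurate μ T O x M v₀ v₁ ε →
      (∀ t < T, Measurable fun z : Auction.Trajectory => Auction.decision O R x z t) →
      (∀ t < T, Auction.IsOptimalBid μ (M t) (v₀ t) (v₁ t) (bstar t)) →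
      Auction.regret μ O R x M v₀ v₁ bstar ≤
        C * (√((d : ℝ) * T) * Real.log T ^ 2 +
          (∑ t ∈ Finset.range T, ε t) * Real.log T ^ (3 / 2 : ℝ)) := by
  refine ⟨400, by norm_num, ?_⟩
  intro T d hT hd O R Ω _ μ _ L x θ₀ θ₁ M v₀ v₁ ε bstar H hacc hdec hopt
  refine (Auction.regret_le H hdec hT hd hacc fun t ht => (hopt t ht).1).trans ?_
  exact Auction.regret_terms_le hT hd
    (Finset.sum_nonneg fun t ht => Auction.error_nonneg hT hacc (Finset.mem_range.1 ht))
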